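/- Let $(M,g)$ be a smooth Riemannian manifold with Levi-Civita connection $\nabla$, let $R(X,Y)Z=\nabla_X\nabla_YZ-\nabla_Y\nabla_XZ-\nabla_{[X,Y]}Z$, $R(X,Y,Z,U)=g(R(X,Y)Z,U)$, and let $\tau=\sum_{i,j}R(e_i,e_j,e_j,e_i)$ ($\{e_i\}$ an orthonormal basis of the tangent space) be the scalar curvature. For a 2-plane $E\subset T_pM$ with orthonormal basis $\{X,Y\}$ define the sectional 1-form of $E$ by $\varphi_E(Z)=(\nabla_ZR)(X,Y,Y,X)$, $Z\in E$ (it does not depend on the orthonormal basis). The manifold $(M,g)$ is called *directed* by a smooth unit 1-form $\eta$ on $M$, with distribution $\Delta=\ker\eta$, if for every $p\in M$ and every 2-plane $E\subset T_pM$ 1. if $E\not\subset\Delta(p)$, then $\varphi_E=k(E,p)\,\eta|_E$ for some real number $k(E,p)$, called the relative sectional curvature of $E$; 2. if $E\subset\Delta(p)$, then $\varphi_E=0$. A directed Riemannian manifold is *of pointwise constant relative sectional curvatures* if at every point $p$ the number $k(E,p)$ is the same for all 2-planes $E\subset T_pM$ with $E\not\subset\Delta(p)$. **Corollary 2.5.**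 Let $(M,g)$ be a directed Riemannian manifold of pointwise constant relative sectional curvatures. Then $(M,g)$ is locally symmetric, i.e. $\nabla R=0$ on $M$, if and only if $d\tau=0$ on $M$. -/

import Mathlib

open Bundle FiberBundle VectorField InnerProductSpace
open scoped Manifold ContDiff

noncomputable section

namespace DirectedRiemannian

variable {E : Type*} [NormedAddCommGroup E] [NormedSpace ℝ E]
  {H : Type*} [TopologicalSpace H] (I : ModelWithCorners ℝ E H)
  {M : Type*} [TopologicalSpace M] [ChartedSpace H M] [IsManifold I ∞ M]
  [RiemannianBundle (fun x : M ↦ TangentSpace I x)]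

/-- The right-hand side of the Koszul formula, as a function on `M`:
`½ (X g(Y,Z) + Y g(X,Z) - Z g(X,Y) + g([X,Y],Z) - g([X,Z],Y) - g([Y,Z],X))`. -/
def koszul (X Y Z : Π x : M, TangentSpace I x) (x : M) : ℝ :=
  1 / 2 * (mvfderiv I (fun q ↦ inner ℝ (Y q) (Z q)) x (X x)
    + mvfderiv I (fun q ↦ inner ℝ (X q) (Z q)) x (Y x)
    - mvfderiv I (fun q ↦ inner ℝ (X q) (Y q)) x (Z x)
    + inner ℝ (mlieBracket I X Y x) (Z x)
    - inner ℝ (mlieBracket I X Z x) (Y x)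
    - inner ℝ (mlieBracket I Y Z x) (X x))

variable [IsContMDiffRiemannianBundle I ∞ E (fun x : M ↦ TangentSpace I x)]

theorem mdiff_inner {X Y : Π x : M, TangentSpace I x} {x : M}
    (hX : MDiffAt (T% X) x) (hY : MDiffAt (T% Y) x) :
    MDiffAt (fun q ↦ inner ℝ (X q) (Y q)) x :=
  MDifferentiableAt.inner_bundle (E := fun x : M ↦ TangentSpace I x) hX hY

variable [FiniteDimensional ℝ E]

theorem koszul_tensorial_left {Y Z : Π x : M, TangentSpace I x} {x : M}
    (hY : MDiffAt (T% Y) x) (hZ : MDiffAt (T% Z) x) :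
    TensorialAt I E (fun X : Π x : M, TangentSpace I x ↦ koszul I X Y Z x) x where
  smul {f X} hf hX := by
    have : CompleteSpace E := FiniteDimensional.complete ℝ E
    have h1 : mvfderiv I (fun q ↦ inner ℝ (f q • X q) (Z q)) x
        = f x • mvfderiv I (fun q ↦ inner ℝ (X q) (Z q)) x
          + inner ℝ (X x) (Z x) • mvfderiv I f x := by
      simp only [real_inner_smul_left]
      exact mvfderiv_fun_mul hf (mdiff_inner I hX hZ)
    have h2 : mvfderiv I (fun q ↦ inner ℝ (f q • X q) (Y q)) x
        = f x • mvfderiv I (fun q ↦ inner ℝ (X q) (Y q)) x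
          + inner ℝ (X x) (Y x) • mvfderiv I f x := by
      simp only [real_inner_smul_left]
      exact mvfderiv_fun_mul hf (mdiff_inner I hX hY)
    simp only [koszul, Pi.smul_apply', h1, h2]
    simp [mlieBracket_smul_left hf hX, inner_add_left, inner_neg_left,
      real_inner_smul_left, inner_smul_right]
    ring
  add {X X'} hX hX' := by
    have : CompleteSpace E := FiniteDimensional.complete ℝ E
    have h1 : mvfderiv I (fun q ↦ inner ℝ (X q + X' q) (Z q)) x
        = mvfderiv I (fun q ↦ inner ℝ (X q) (Z q)) x
          + mvfderiv I (fun q ↦ inner ℝ (X' q) (Z q)) x := by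
      simp only [inner_add_left]
      exact mvfderiv_fun_add (mdiff_inner I hX hZ) (mdiff_inner I hX' hZ)
    have h2 : mvfderiv I (fun q ↦ inner ℝ (X q + X' q) (Y q)) x
        = mvfderiv I (fun q ↦ inner ℝ (X q) (Y q)) x
          + mvfderiv I (fun q ↦ inner ℝ (X' q) (Y q)) x := by
      simp only [inner_add_left]
      exact mvfderiv_fun_add (mdiff_inner I hX hY) (mdiff_inner I hX' hY)
    simp only [koszul, Pi.add_apply, h1, h2]
    simp [mlieBracket_add_left hX hX', inner_add_left, inner_add_right]
    ring

theorem koszul_tensorial_right {X Y : Π x : M, TangentSpace I x} {x : M}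
    (hX : MDiffAt (T% X) x) (hY : MDiffAt (T% Y) x) :
    TensorialAt I E (fun Z : Π x : M, TangentSpace I x ↦ koszul I X Y Z x) x where
  smul {f Z} hf hZ := by
    have : CompleteSpace E := FiniteDimensional.complete ℝ E
    have h1 : mvfderiv I (fun q ↦ inner ℝ (X q) (f q • Z q)) x
        = f x • mvfderiv I (fun q ↦ inner ℝ (X q) (Z q)) x
          + inner ℝ (X x) (Z x) • mvfderiv I f x := by
      simp only [real_inner_smul_right]
      exact mvfderiv_fun_mul hf (mdiff_inner I hX hZ)
    have h2 : mvfderiv I (fun q ↦ inner ℝ (Y q) (f q • Z q)) x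
        = f x • mvfderiv I (fun q ↦ inner ℝ (Y q) (Z q)) x
          + inner ℝ (Y x) (Z x) • mvfderiv I f x := by
      simp only [real_inner_smul_right]
      exact mvfderiv_fun_mul hf (mdiff_inner I hY hZ)
    simp only [koszul, Pi.smul_apply', h1, h2]
    simp [mlieBracket_smul_right hf hZ, inner_add_left,
      real_inner_smul_left, inner_smul_right, real_inner_comm (Z x)]
    ring
  add {Z Z'} hZ hZ' := by
    have : CompleteSpace E := FiniteDimensional.complete ℝ E
    have h1 : mvfderiv I (fun q ↦ inner ℝ (X q) (Z q + Z' q)) x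
        = mvfderiv I (fun q ↦ inner ℝ (X q) (Z q)) x
          + mvfderiv I (fun q ↦ inner ℝ (X q) (Z' q)) x := by
      simp only [inner_add_right]
      exact mvfderiv_fun_add (mdiff_inner I hX hZ) (mdiff_inner I hX hZ')
    have h2 : mvfderiv I (fun q ↦ inner ℝ (Y q) (Z q + Z' q)) x
        = mvfderiv I (fun q ↦ inner ℝ (Y q) (Z q)) x
          + mvfderiv I (fun q ↦ inner ℝ (Y q) (Z' q)) x := by
      simp only [inner_add_right]
      exact mvfderiv_fun_add (mdiff_inner I hY hZ) (mdiff_inner I hY hZ')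
    simp only [koszul, Pi.add_apply, h1, h2]
    simp [mlieBracket_add_right hZ hZ', inner_add_left, inner_add_right]
    ring

open scoped Classical in
/-- The bilinear form `(x, z) ↦ g(∇_x Y, z)` on `T_pM` given by the Koszul formula, for a vector
field `Y` that is differentiable at `p`. -/
def koszulForm (Y : Π x : M, TangentSpace I x) (p : M) :
    TangentSpace I p →L[ℝ] TangentSpace I p →L[ℝ] ℝ :=
  if hY : MDiffAt (T% Y) p then
    TensorialAt.mkHom₂ (fun X Z : Π x : M, TangentSpace I x ↦ koszul I X Y Z p) p
      (fun _ hZ ↦ koszul_tensorial_left I hY hZ) (fun _ hX ↦ koszul_tensorial_right I hX hY)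
  else 0

theorem koszulForm_apply {X Y Z : Π x : M, TangentSpace I x} {p : M}
    (hX : MDiffAt (T% X) p) (hY : MDiffAt (T% Y) p) (hZ : MDiffAt (T% Z) p) :
    koszulForm I Y p (X p) (Z p) = koszul I X Y Z p := by
  rw [koszulForm, dif_pos hY]
  exact TensorialAt.mkHom₂_apply _ _ hX hZ

instance (p : M) : FiniteDimensional ℝ (TangentSpace I p) :=
  inferInstanceAs (FiniteDimensional ℝ E)

instance (p : M) : CompleteSpace (TangentSpace I p) :=
  FiniteDimensional.complete ℝ _

/-- `∇_v Y ∈ T_pM`: the vector that represents `z ↦ g(∇_v Y, z)`. -/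
def leviCivitaFun (Y : Π x : M, TangentSpace I x) (p : M) :
    TangentSpace I p →L[ℝ] TangentSpace I p :=
  LinearMap.toContinuousLinearMap
    { toFun v := (toDual ℝ (TangentSpace I p)).symm (koszulForm I Y p v)
      map_add' v w := by simp
      map_smul' c v := by simp }

theorem inner_leviCivitaFun (Y : Π x : M, TangentSpace I x) (p : M) (v z : TangentSpace I p) :
    inner ℝ (leviCivitaFun I Y p v) z = koszulForm I Y p v z := by
  simp [leviCivitaFun]

theorem inner_leviCivitaFun_eq_koszul {X Y Z : Π x : M, TangentSpace I x} {p : M}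
    (hX : MDiffAt (T% X) p) (hY : MDiffAt (T% Y) p) (hZ : MDiffAt (T% Z) p) :
    inner ℝ (leviCivitaFun I Y p (X p)) (Z p) = koszul I X Y Z p := by
  rw [inner_leviCivitaFun, koszulForm_apply I hX hY hZ]

theorem koszul_add {X Y Y' Z : Π x : M, TangentSpace I x} {x : M}
    (hX : MDiffAt (T% X) x) (hY : MDiffAt (T% Y) x) (hY' : MDiffAt (T% Y') x)
    (hZ : MDiffAt (T% Z) x) :
    koszul I X (Y + Y') Z x = koszul I X Y Z x + koszul I X Y' Z x := by
  have : CompleteSpace E := FiniteDimensional.complete ℝ E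
  have h1 : mvfderiv I (fun q ↦ inner ℝ (Y q + Y' q) (Z q)) x
      = mvfderiv I (fun q ↦ inner ℝ (Y q) (Z q)) x
        + mvfderiv I (fun q ↦ inner ℝ (Y' q) (Z q)) x := by
    simp only [inner_add_left]
    exact mvfderiv_fun_add (mdiff_inner I hY hZ) (mdiff_inner I hY' hZ)
  have h2 : mvfderiv I (fun q ↦ inner ℝ (X q) (Y q + Y' q)) x
      = mvfderiv I (fun q ↦ inner ℝ (X q) (Y q)) x
        + mvfderiv I (fun q ↦ inner ℝ (X q) (Y' q)) x := by
    simp only [inner_add_right]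
    exact mvfderiv_fun_add (mdiff_inner I hX hY) (mdiff_inner I hX hY')
  simp only [koszul, Pi.add_apply, h1, h2]
  simp [mlieBracket_add_left hY hY', mlieBracket_add_right hY hY', inner_add_left,
    inner_add_right]
  ring

theorem koszul_smul {f : M → ℝ} {X Y Z : Π x : M, TangentSpace I x} {x : M}
    (hf : MDiffAt f x) (hX : MDiffAt (T% X) x) (hY : MDiffAt (T% Y) x)
    (hZ : MDiffAt (T% Z) x) :
    koszul I X (f • Y) Z x
      = f x * koszul I X Y Z x + mvfderiv I f x (X x) * inner ℝ (Y x) (Z x) := by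
  have : CompleteSpace E := FiniteDimensional.complete ℝ E
  have h1 : mvfderiv I (fun q ↦ inner ℝ (f q • Y q) (Z q)) x
      = f x • mvfderiv I (fun q ↦ inner ℝ (Y q) (Z q)) x
        + inner ℝ (Y x) (Z x) • mvfderiv I f x := by
    simp only [real_inner_smul_left]
    exact mvfderiv_fun_mul hf (mdiff_inner I hY hZ)
  have h2 : mvfderiv I (fun q ↦ inner ℝ (X q) (f q • Y q)) x
      = f x • mvfderiv I (fun q ↦ inner ℝ (X q) (Y q)) x
        + inner ℝ (X x) (Y x) • mvfderiv I f x := by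
    simp only [real_inner_smul_right]
    exact mvfderiv_fun_mul hf (mdiff_inner I hX hY)
  simp only [koszul, Pi.smul_apply', h1, h2]
  simp [mlieBracket_smul_left hf hY, mlieBracket_smul_right hf hY, inner_add_left,
    inner_add_right, inner_neg_right, real_inner_smul_left, inner_smul_right,
    real_inner_comm (X x)]
  ring

variable (M) in
/-- The Levi-Civita connection of `(M, g)`; `leviCivita I M Y p v` is `(∇_v Y)(p)`. -/
def leviCivita : CovariantDerivative I E (TangentSpace I : M → Type _) where
  toFun := leviCivitaFun I
  isCovariantDerivativeOnUniv :=
    { add := by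
        intro σ σ' p hσ hσ' _
        ext v
        refine ext_inner_right ℝ fun z ↦ ?_
        have h (Y : Π x : M, TangentSpace I x) (hY : MDiffAt (T% Y) p) :
            inner ℝ (leviCivitaFun I Y p v) z = koszul I (extend E v) Y (extend E z) p := by
          have := inner_leviCivitaFun_eq_koszul I (mdifferentiableAt_extend I E v) hY
            (mdifferentiableAt_extend I E z)
          simpa using this
        simp only [add_apply, inner_add_left]
        rw [h _ hσ, h _ hσ', h _ (mdifferentiableAt_add_section hσ hσ'),
          koszul_add I (mdifferentiableAt_extend I E v) hσ hσ' (mdifferentiableAt_extend I E z)]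
      leibniz := by
        intro σ f p hσ hf _
        ext v
        refine ext_inner_right ℝ fun z ↦ ?_
        have h (Y : Π x : M, TangentSpace I x) (hY : MDiffAt (T% Y) p) :
            inner ℝ (leviCivitaFun I Y p v) z = koszul I (extend E v) Y (extend E z) p := by
          have := inner_leviCivitaFun_eq_koszul I (mdifferentiableAt_extend I E v) hY
            (mdifferentiableAt_extend I E z)
          simpa using this
        simp only [add_apply, smul_apply,
          ContinuousLinearMap.smulRight_apply, inner_add_left, real_inner_smul_left]
        rw [h _ hσ, h _ (hf.smul_section hσ),
          koszul_smul I hf (mdifferentiableAt_extend I E v) hσ (mdifferentiableAt_extend I E z)]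
        simp }

theorem inner_leviCivita {X Y Z : Π x : M, TangentSpace I x} {p : M}
    (hX : MDiffAt (T% X) p) (hY : MDiffAt (T% Y) p) (hZ : MDiffAt (T% Z) p) :
    inner ℝ (leviCivita I M Y p (X p)) (Z p) = koszul I X Y Z p :=
  inner_leviCivitaFun_eq_koszul I hX hY hZ

/-- The Levi-Civita connection is torsion-free. -/
theorem leviCivita_torsionFree {X Y : Π x : M, TangentSpace I x} {p : M}
    (hX : MDiffAt (T% X) p) (hY : MDiffAt (T% Y) p) :
    leviCivita I M Y p (X p) - leviCivita I M X p (Y p) = mlieBracket I X Y p := by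
  refine ext_inner_right ℝ fun z ↦ ?_
  have hz := mdifferentiableAt_extend I E z
  have h1 := inner_leviCivita I hX hY hz
  have h2 := inner_leviCivita I hY hX hz
  rw [extend_apply_self] at h1 h2
  rw [inner_sub_left, h1, h2]
  simp only [koszul, real_inner_comm (X _) (Y _), mlieBracket_swap_apply (V := Y) (W := X),
    inner_neg_left, extend_apply_self]
  ring

/-- The Levi-Civita connection is compatible with the metric. -/
theorem leviCivita_metric {X Y Z : Π x : M, TangentSpace I x} {p : M}
    (hX : MDiffAt (T% X) p) (hY : MDiffAt (T% Y) p) (hZ : MDiffAt (T% Z) p) :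
    mvfderiv I (fun q ↦ inner ℝ (Y q) (Z q)) p (X p)
      = inner ℝ (leviCivita I M Y p (X p)) (Z p) + inner ℝ (Y p) (leviCivita I M Z p (X p)) := by
  rw [real_inner_comm _ (Y p), inner_leviCivita I hX hY hZ, inner_leviCivita I hX hZ hY]
  simp only [koszul, real_inner_comm (Y _) (Z _), mlieBracket_swap_apply (V := Z) (W := Y),
    inner_neg_left]
  ring

/-- The curvature operator `R(X,Y)Z = ∇_X ∇_Y Z - ∇_Y ∇_X Z - ∇_{[X,Y]} Z` on vector fields. -/
def curvatureOperator (X Y Z : Π x : M, TangentSpace I x) (p : M) : TangentSpace I p :=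
  leviCivita I M (fun q ↦ leviCivita I M Z q (Y q)) p (X p)
    - leviCivita I M (fun q ↦ leviCivita I M Z q (X q)) p (Y p)
    - leviCivita I M Z p (mlieBracket I X Y p)

/-- The curvature tensor `R(X,Y,Z,U) = g(R(X,Y)Z,U)` of type `(0,4)` on vector fields, as a
function on `M`. -/
def curvature (X Y Z U : Π x : M, TangentSpace I x) (p : M) : ℝ :=
  inner ℝ (curvatureOperator I X Y Z p) (U p)

/-- The covariant derivative `(∇_W R)(X,Y,Z,U)` of the curvature tensor on vector fields. -/
def covDerivCurvature (W X Y Z U : Π x : M, TangentSpace I x) (p : M) : ℝ :=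
  mvfderiv I (curvature I X Y Z U) p (W p)
    - curvature I (fun q ↦ leviCivita I M X q (W q)) Y Z U p
    - curvature I X (fun q ↦ leviCivita I M Y q (W q)) Z U p
    - curvature I X Y (fun q ↦ leviCivita I M Z q (W q)) U p
    - curvature I X Y Z (fun q ↦ leviCivita I M U q (W q)) p

/-- The value of the tensor `R` on tangent vectors at `p`. The vectors are extended to vector
fields that are smooth near `p`; as `R` is a tensor, the extension does not matter. -/
def curvatureAt (p : M) (x y z u : TangentSpace I p) : ℝ :=
  curvature I (extend E x) (extend E y) (extend E z) (extend E u) p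

/-- The value of the tensor `∇R` on tangent vectors `(w, x, y, z, u)` at `p`. The vectors are
extended to vector fields that are smooth near `p`; as `∇R` is a tensor, the extension does not
matter. -/
def covDerivCurvatureAt (p : M) (w x y z u : TangentSpace I p) : ℝ :=
  covDerivCurvature I (extend E w) (extend E x) (extend E y) (extend E z) (extend E u) p

variable (M) in
/-- `(M, g)` is locally symmetric: `∇R = 0`. -/
def IsLocallySymmetric : Prop :=
  ∀ (p : M) (w x y z u : TangentSpace I p), covDerivCurvatureAt I p w x y z u = 0

/-- The scalar curvature `τ(p) = ∑ᵢⱼ R(eᵢ,eⱼ,eⱼ,eᵢ)` for an orthonormal basis `e` of `T_pM`. -/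
def scalarCurvature (p : M) : ℝ :=
  let e := stdOrthonormalBasis ℝ (TangentSpace I p)
  ∑ i, ∑ j, curvatureAt I p (e i) (e j) (e j) (e i)

/-- The sectional 1-form `φ_P(z) = (∇_z R)(x,y,y,x)` of a 2-plane `P` in `T_pM`, where `x, y` is an
orthonormal basis of `P` (the symmetries of `∇R` make it independent of that basis). -/
def sectionalForm {p : M} (P : Submodule ℝ (TangentSpace I p)) (hP : Module.finrank ℝ P = 2)
    (z : P) : ℝ :=
  let e := (stdOrthonormalBasis ℝ P).reindex (finCongr hP)
  covDerivCurvatureAt I p z (e 0) (e 1) (e 1) (e 0)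

variable {I}

/-- The distribution `Δ` of a 1-form `η`, as a subspace of each tangent space. -/
def distribution (η : Π p : M, TangentSpace I p →L[ℝ] ℝ) (p : M) :
    Submodule ℝ (TangentSpace I p) :=
  LinearMap.ker (η p : TangentSpace I p →ₗ[ℝ] ℝ)

/-- `(M, g)` is directed by the (smooth) unit 1-form `η`. -/
structure IsDirectedBy (η : Π p : M, TangentSpace I p →L[ℝ] ℝ) : Prop where
  smooth : ContMDiff I (I.prod 𝓘(ℝ, E →L[ℝ] ℝ)) ∞
    (fun p ↦ TotalSpace.mk' (E →L[ℝ] ℝ) (E := fun p : M ↦ TangentSpace I p →L[ℝ] ℝ) p (η p))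
  unit : ∀ p, ‖η p‖ = 1
  collinear : ∀ (p : M) (P : Submodule ℝ (TangentSpace I p)) (hP : Module.finrank ℝ P = 2),
    ¬ P ≤ distribution η p → ∃ k : ℝ, ∀ z : P, sectionalForm I P hP z = k * η p z
  vanishing : ∀ (p : M) (P : Submodule ℝ (TangentSpace I p)) (hP : Module.finrank ℝ P = 2),
    P ≤ distribution η p → ∀ z : P, sectionalForm I P hP z = 0

/-- The relative sectional curvature `k(P, p)`: the number `k` with `φ_P = k • η|_P`. It exists, if
`M` is directed by `η`, and is unique for every 2-plane `P` not contained in `Δ`. -/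
def relativeSectionalCurvature (η : Π p : M, TangentSpace I p →L[ℝ] ℝ) {p : M}
    (P : Submodule ℝ (TangentSpace I p)) (hP : Module.finrank ℝ P = 2) : ℝ :=
  Classical.epsilon fun k : ℝ ↦ ∀ z : P, sectionalForm I P hP z = k * η p z

/-- At each point `p`, the relative sectional curvature `k(P, p)` is the same for all 2-planes `P`
in `T_pM` that are not contained in `Δ`. -/
def HasPointwiseConstantRelativeSectionalCurvature
    (η : Π p : M, TangentSpace I p →L[ℝ] ℝ) : Prop :=
  ∀ (p : M) (P Q : Submodule ℝ (TangentSpace I p))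
    (hP : Module.finrank ℝ P = 2) (hQ : Module.finrank ℝ Q = 2),
    ¬ P ≤ distribution η p → ¬ Q ≤ distribution η p →
      relativeSectionalCurvature η P hP = relativeSectionalCurvature η Q hQ

end DirectedRiemannian

end

/-! Everything takes place at one point `p`, in dimension `n`. The two conditions on `φ_E`, together
with pointwise constancy, give one number `k` with `(∇_x R)(x,y,y,x) = k η(x) (|x|²|y|² - ⟨x,y⟩²)`
for all tangent vectors `x`, `y` (`exists_relativeSectionalCurvature`,
`covDerivCurvatureAt_of_sectionalForm`). This only sees directions of differentiation inside the
plane. Polarization in `x` relates `(∇_w R)(x,y,y,x)` to `(∇_x R)(x,y,y,w)`, and the second Bianchi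
identity gives another relation between these terms. Together they express `(∇_w R)(x,y,y,x)`
through `k η` and the metric for every `w` (`IsCurvatureTensor.two_mul_sectional`).

Taking the trace gives `2 dτ = k (n - 1)(n + 2) η`. If `dτ = 0`, then `k = 0`: a nonzero `k` comes
from an actual 2-plane, so that `n ≥ 2`, and `η ≠ 0`. Hence all `(∇_w R)(x,y,y,x)` vanish, and `∇R =
0` because an algebraic curvature tensor is determined by its sectional curvatures. The converse is
that `dτ` is the trace of `∇R` (`exists_mvfderiv_scalarCurvature`).

Most of the work lies in the foundations. Starting from the Koszul formula, `∇` must be shown to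
preserve smoothness, and `R` and `∇R` to be tensors with the usual symmetries and both Bianchi
identities. -/

open Filter Topology

/-! ### Smoothness near a point, and the Lie bracket as a commutator of derivations. -/

noncomputable section

namespace DirectedRiemannian

variable {E : Type*} [NormedAddCommGroup E] [NormedSpace ℝ E]
  {H : Type*} [TopologicalSpace H] {I : ModelWithCorners ℝ E H}
  {M : Type*} [TopologicalSpace M] [ChartedSpace H M]

variable (I) in
/-- The function `f` is smooth on a neighbourhood of `p`. -/
def SmoothFunNear (f : M → ℝ) (p : M) : Prop :=
  ∀ᶠ q in 𝓝 p, CMDiffAt ∞ f q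

section Basic

variable {f g : M → ℝ} {p : M}

theorem SmoothFunNear.contMDiffAt (h : SmoothFunNear I f p) : CMDiffAt ∞ f p := h.self_of_nhds

theorem SmoothFunNear.mdiff (h : SmoothFunNear I f p) : MDiffAt f p :=
  h.contMDiffAt.mdifferentiableAt (by simp)

theorem SmoothFunNear.near (h : SmoothFunNear I f p) : ∀ᶠ q in 𝓝 p, SmoothFunNear I f q :=
  eventually_eventually_nhds.2 h

theorem SmoothFunNear.congr (h : SmoothFunNear I f p) (hfg : g =ᶠ[𝓝 p] f) :
    SmoothFunNear I g p := by
  filter_upwards [h, hfg.eventually_nhds] with q h₁ h₂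
  exact h₁.congr_of_eventuallyEq h₂

theorem SmoothFunNear.const (c : ℝ) : SmoothFunNear I (fun _ : M ↦ c) p :=
  .of_forall fun _ ↦ contMDiffAt_const

theorem SmoothFunNear.sum {ι : Type*} {s : Finset ι} {F : ι → M → ℝ}
    (h : ∀ i ∈ s, SmoothFunNear I (F i) p) : SmoothFunNear I (fun q ↦ ∑ i ∈ s, F i q) p := by
  have h' : ∀ᶠ q in 𝓝 p, ∀ i ∈ s, CMDiffAt ∞ (F i) q :=
    (Filter.eventually_all_finset s).2 h
  filter_upwards [h'] with q hq
  exact ContMDiffAt.sum hq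

variable [IsManifold I ∞ M]

variable (I) in
/-- The vector field `X` is smooth on a neighbourhood of `p`. -/
def SmoothNear (X : Π x : M, TangentSpace I x) (p : M) : Prop :=
  ∀ᶠ q in 𝓝 p, CMDiffAt ∞ (T% X) q

variable {X Y : Π x : M, TangentSpace I x}

theorem SmoothNear.contMDiffAt (h : SmoothNear I X p) : CMDiffAt ∞ (T% X) p := h.self_of_nhds

theorem SmoothNear.mdiff (h : SmoothNear I X p) : MDiffAt (T% X) p :=
  h.contMDiffAt.mdifferentiableAt (by simp)

theorem SmoothNear.near (h : SmoothNear I X p) : ∀ᶠ q in 𝓝 p, SmoothNear I X q :=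
  eventually_eventually_nhds.2 h

theorem SmoothNear.add (hX : SmoothNear I X p) (hY : SmoothNear I Y p) :
    SmoothNear I (X + Y) p := by
  filter_upwards [hX, hY] with q h₁ h₂ using h₁.add_section h₂

theorem SmoothNear.sub (hX : SmoothNear I X p) (hY : SmoothNear I Y p) :
    SmoothNear I (X - Y) p := by
  filter_upwards [hX, hY] with q h₁ h₂ using h₁.sub_section h₂

theorem SmoothNear.smul (hf : SmoothFunNear I f p) (hX : SmoothNear I X p) :
    SmoothNear I (f • X) p := by
  filter_upwards [hf, hX] with q h₁ h₂ using h₁.smul_section h₂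

theorem smoothNear_zero : SmoothNear I (0 : Π x : M, TangentSpace I x) p :=
  .of_forall fun _ ↦ (contMDiff_zeroSection ℝ (TangentSpace I)).contMDiffAt

theorem smoothNear_extend (v : TangentSpace I p) :
    SmoothNear I (extend E v : Π x : M, TangentSpace I x) p := by
  obtain ⟨s, hs, h⟩ := exists_contMDiffOn_extend (k := ∞) I E v
  filter_upwards [eventually_mem_nhds_iff.2 hs] with q hq using h.contMDiffAt hq

theorem smoothNear_mlieBracket [CompleteSpace E] (hX : SmoothNear I X p) (hY : SmoothNear I Y p) :
    SmoothNear I (mlieBracket I X Y) p := by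
  have : IsManifold I (((⊤ : ℕ∞) : ℕ∞ω) + 1) M := by simpa using! (inferInstance : IsManifold I ∞ M)
  have : IsManifold I (minSmoothness ℝ 2) M := by
    simpa using (inferInstance : IsManifold I 2 M)
  filter_upwards [hX, hY] with q h₁ h₂
  exact ContMDiffAt.mlieBracket_vectorField (m := ⊤) (n := ⊤) h₁ h₂ (by simp)

theorem contMDiffAt_mvfderiv (hf : CMDiffAt ∞ f p) (hX : CMDiffAt ∞ (T% X) p) :
    CMDiffAt ∞ (fun q ↦ mvfderiv I f q (X q)) p := by
  have h1 := hf.mfderiv_const (m := ∞) (by simp)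
  have h2 := ContMDiffAt.clm_apply_of_inCoordinates
    (E₁ := (TangentSpace I : M → Type _)) (E₂ := (TangentSpace 𝓘(ℝ, ℝ) : ℝ → Type _))
    (b₁ := id) (b₂ := f) (ϕ := mfderiv I 𝓘(ℝ, ℝ) f) h1 hX hf
  have h3 := (contMDiffAt_totalSpace.1 h2).2
  refine h3.congr_of_eventuallyEq (.of_forall fun q ↦ ?_)
  simp [mvfderiv]
  rfl

theorem smoothFunNear_mvfderiv (hf : SmoothFunNear I f p) (hX : SmoothNear I X p) :
    SmoothFunNear I (fun q ↦ mvfderiv I f q (X q)) p := by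
  filter_upwards [hf, hX] with q h₁ h₂ using contMDiffAt_mvfderiv h₁ h₂

/-- Directional derivatives along vector fields commute up to the Lie bracket. -/
theorem mvfderiv_mlieBracket [CompleteSpace E]
    (hX : SmoothNear I X p) (hY : SmoothNear I Y p) (hf : SmoothFunNear I f p) :
    mvfderiv I f p (mlieBracket I X Y p)
      = mvfderiv I (fun q ↦ mvfderiv I f q (Y q)) p (X p)
        - mvfderiv I (fun q ↦ mvfderiv I f q (X q)) p (Y p) := by
  have : IsManifold I (minSmoothness ℝ 2) M := by
    simpa using (inferInstance : IsManifold I 2 M)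
  have : IsManifold I (minSmoothness ℝ 3) M := by
    simpa using (inferInstance : IsManifold I 3 M)
  rcases subsingleton_or_nontrivial E with hE | hE
  · have h (v : TangentSpace I p) : v = 0 := Subsingleton.elim (α := E) v 0
    rw [h (mlieBracket I X Y p), h (X p), h (Y p)]
    simp
  -- The Leibniz form of the Jacobi identity is applied to `X`, `Y` and `f • Z`, with `Z p ≠ 0`.
  -- After subtraction of `f p` times the identity for `Z`, what remains is the claim multiplied by
  -- `Z p`.
  obtain ⟨v, hv⟩ := exists_ne (0 : E)
  let Z : Π x : M, TangentSpace I x := extend E (x := p) (v : TangentSpace I p)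
  have hZ : SmoothNear I Z p := smoothNear_extend _
  have hZp : Z p ≠ 0 := by
    rw [show Z p = (v : TangentSpace I p) from extend_apply_self ..]
    exact hv
  have key {X Y : Π x : M, TangentSpace I x} (hX : SmoothNear I X p) (hY : SmoothNear I Y p) :
      mlieBracket I X (mlieBracket I Y (f • Z)) p
        = mvfderiv I (fun q ↦ mvfderiv I f q (Y q)) p (X p) • Z p
          + mvfderiv I f p (Y p) • mlieBracket I X Z p
          + mvfderiv I f p (X p) • mlieBracket I Y Z p
          + f p • mlieBracket I X (mlieBracket I Y Z) p := by
    have hYf := smoothFunNear_mvfderiv hf hY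
    have hYZ := smoothNear_mlieBracket hY hZ
    have h1 : mlieBracket I Y (f • Z)
        =ᶠ[𝓝 p] (fun q ↦ mvfderiv I f q (Y q)) • Z + f • mlieBracket I Y Z := by
      filter_upwards [hf.near, hZ.near] with q h₁ h₂
      exact mlieBracket_smul_right h₁.mdiff h₂.mdiff
    rw [EventuallyEq.mlieBracket_vectorField_eq (V₁ := X) EventuallyEq.rfl h1,
      mlieBracket_add_right (hYf.mdiff.smul_section hZ.mdiff) (hf.mdiff.smul_section hYZ.mdiff),
      mlieBracket_smul_right hYf.mdiff hZ.mdiff, mlieBracket_smul_right hf.mdiff hYZ.mdiff]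
    abel
  have two {X : Π x : M, TangentSpace I x} (hX : SmoothNear I X p) :
      CMDiffAt (minSmoothness ℝ 2) (T% X) p := by
    simpa using hX.contMDiffAt.of_le (m := 2) ENat.LEInfty.out
  have hXY := smoothNear_mlieBracket hX hY
  have h1 := leibniz_identity_mlieBracket_apply (two hX) (two hY) (two (.smul hf hZ))
  have h2 := leibniz_identity_mlieBracket_apply (two hX) (two hY) (two hZ)
  rw [key hX hY, key hY hX, mlieBracket_smul_right hf.mdiff hZ.mdiff, h2] at h1
  have h3 : (mvfderiv I f p (mlieBracket I X Y p)
      - (mvfderiv I (fun q ↦ mvfderiv I f q (Y q)) p (X p)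
        - mvfderiv I (fun q ↦ mvfderiv I f q (X q)) p (Y p))) • Z p = 0 := by
    rw [← sub_eq_zero] at h1
    refine Eq.trans ?_ ((congrArg Neg.neg h1).trans neg_zero)
    module
  rcases smul_eq_zero.1 h3 with h | h
  · linarith
  · exact absurd h hZp

end Basic

end DirectedRiemannian

end

/-! ### Smooth orthonormal frames and smoothness of the covariant derivative. -/

noncomputable section

namespace DirectedRiemannian

variable {E : Type*} [NormedAddCommGroup E] [NormedSpace ℝ E]
  {H : Type*} [TopologicalSpace H] {I : ModelWithCorners ℝ E H}
  {M : Type*} [TopologicalSpace M] [ChartedSpace H M] [IsManifold I ∞ M]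

section Closure

variable {X Y Z : Π x : M, TangentSpace I x} {p : M}

theorem SmoothNear.congr (h : SmoothNear I X p) (hXY : Y =ᶠ[𝓝 p] X) : SmoothNear I Y p := by
  filter_upwards [h, hXY.eventually_nhds] with q h₁ h₂
  refine h₁.congr_of_eventuallyEq ?_
  filter_upwards [h₂] with r hr
  rw [hr]

theorem SmoothNear.sum {ι : Type*} {s : Finset ι} {F : ι → Π x : M, TangentSpace I x}
    (h : ∀ i ∈ s, SmoothNear I (F i) p) : SmoothNear I (fun q ↦ ∑ i ∈ s, F i q) p := by
  have h' : ∀ᶠ q in 𝓝 p, ∀ i ∈ s, CMDiffAt ∞ (T% (F i)) q :=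
    (Filter.eventually_all_finset s).2 h
  filter_upwards [h'] with q hq
  exact ContMDiffAt.sum_section hq

end Closure

variable [RiemannianBundle (fun x : M ↦ TangentSpace I x)]
  [IsContMDiffRiemannianBundle I ∞ E (fun x : M ↦ TangentSpace I x)]

section Metric

variable {X Y Z : Π x : M, TangentSpace I x} {p : M}

theorem contMDiffAt_inner (hX : CMDiffAt ∞ (T% X) p) (hY : CMDiffAt ∞ (T% Y) p) :
    CMDiffAt ∞ (fun q ↦ inner ℝ (X q) (Y q)) p :=
  ContMDiffAt.inner_bundle (E := fun x : M ↦ TangentSpace I x) hX hY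

theorem smoothFunNear_inner (hX : SmoothNear I X p) (hY : SmoothNear I Y p) :
    SmoothFunNear I (fun q ↦ inner ℝ (X q) (Y q)) p := by
  filter_upwards [hX, hY] with q h₁ h₂ using contMDiffAt_inner h₁ h₂

theorem smoothFunNear_koszul [CompleteSpace E] (hX : SmoothNear I X p) (hY : SmoothNear I Y p)
    (hZ : SmoothNear I Z p) : SmoothFunNear I (koszul I X Y Z) p := by
  filter_upwards [smoothFunNear_mvfderiv (smoothFunNear_inner hY hZ) hX,
    smoothFunNear_mvfderiv (smoothFunNear_inner hX hZ) hY,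
    smoothFunNear_mvfderiv (smoothFunNear_inner hX hY) hZ,
    smoothFunNear_inner (smoothNear_mlieBracket hX hY) hZ,
    smoothFunNear_inner (smoothNear_mlieBracket hX hZ) hY,
    smoothFunNear_inner (smoothNear_mlieBracket hY hZ) hX] with q h₁ h₂ h₃ h₄ h₅ h₆
  exact contMDiffAt_const.mul (((((h₁.add h₂).sub h₃).add h₄).sub h₅).sub h₆)

/-- Strong induction along the Gram–Schmidt recursion. The denominators are squared norms, which are
smooth as inner products and nonzero at `p` by linear independence. -/
theorem contMDiffAt_gramSchmidt {n : ℕ} {s : Fin n → Π x : M, TangentSpace I x}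
    (hs : ∀ i, CMDiffAt ∞ (T% (s i)) p) (hli : LinearIndependent ℝ (fun i ↦ s i p)) (i : Fin n) :
    CMDiffAt ∞ (T% (fun q ↦ gramSchmidt ℝ (fun j ↦ s j q) i)) p := by
  induction i using WellFoundedLT.induction with
  | ind i ih =>
    have h : (fun q ↦ gramSchmidt ℝ (fun j ↦ s j q) i)
        = s i - fun q ↦ ∑ j ∈ Finset.Iio i,
          (inner ℝ (gramSchmidt ℝ (fun j ↦ s j q) j) (s i q)
            / inner ℝ (gramSchmidt ℝ (fun j ↦ s j q) j) (gramSchmidt ℝ (fun j ↦ s j q) j))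
              • gramSchmidt ℝ (fun j ↦ s j q) j := by
      funext q
      have := gramSchmidt_def'' ℝ (fun j ↦ s j q) i
      simp only [real_inner_self_eq_norm_sq, Pi.sub_apply]
      exact eq_sub_of_add_eq this.symm
    suffices H : ∀ G : Π x : M, TangentSpace I x, G = _ → CMDiffAt ∞ (T% G) p from H _ h
    rintro _ rfl
    refine (hs i).sub_section (ContMDiffAt.sum_section fun j hj ↦ ?_)
    have hj' := ih j (Finset.mem_Iio.1 hj)
    refine ContMDiffAt.smul_section ?_ hj'
    refine (contMDiffAt_inner hj' (hs i)).div₀ (contMDiffAt_inner hj' hj') ?_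
    exact inner_self_ne_zero.2 (gramSchmidt_ne_zero j hli)

variable [FiniteDimensional ℝ E]

/-- Near every point there is a smooth orthonormal frame. -/
theorem exists_orthonormal_frame (p : M) :
    ∃ e : Fin (Module.finrank ℝ E) → Π x : M, TangentSpace I x,
      (∀ i, SmoothNear I (e i) p) ∧
      ∀ᶠ q in 𝓝 p, ∃ b : OrthonormalBasis (Fin (Module.finrank ℝ E)) ℝ (TangentSpace I q),
        ∀ i, b i = e i q := by
  let t := trivializationAt E (TangentSpace I : M → Type _) p
  let B := Module.finBasis ℝ E
  let s := t.localFrame B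
  have hframe := t.isLocalFrameOn_localFrame_baseSet I ∞ B
  have hp : ∀ᶠ q in 𝓝 p, q ∈ t.baseSet :=
    t.open_baseSet.mem_nhds (FiberBundle.mem_baseSet_trivializationAt' p)
  have hli {q : M} (hq : q ∈ t.baseSet) : LinearIndependent ℝ (fun i ↦ s i q) :=
    hframe.linearIndependent hq
  refine ⟨fun i q ↦ gramSchmidtNormed ℝ (fun j ↦ s j q) i, fun i ↦ ?_, ?_⟩
  · filter_upwards [hp] with q hq
    have h1 := contMDiffAt_gramSchmidt
      (fun j ↦ hframe.contMDiffAt t.open_baseSet hq j) (hli hq) i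
    have h2 : CMDiffAt ∞ (fun r ↦ (‖gramSchmidt ℝ (fun j ↦ s j r) i‖)⁻¹) q := by
      have h0 : gramSchmidt ℝ (fun j ↦ s j q) i ≠ 0 := gramSchmidt_ne_zero i (hli hq)
      have h3 := contMDiffAt_inner h1 h1
      -- The norm is the square root of a smooth function that is nonzero at `q`, hence it is smooth
      -- there.
      have h4 : CMDiffAt ∞ (fun r ↦ √(inner ℝ (gramSchmidt ℝ (fun j ↦ s j r) i)
          (gramSchmidt ℝ (fun j ↦ s j r) i))) q :=
        (Real.contDiffAt_sqrt (inner_self_ne_zero.2 h0)).contMDiffAt.comp q h3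
      refine ContMDiffAt.inv₀ ?_ (norm_ne_zero_iff.2 h0)
      refine h4.congr_of_eventuallyEq (.of_forall fun r ↦ ?_)
      exact norm_eq_sqrt_real_inner _
    exact h2.smul_section h1
  · filter_upwards [hp] with q hq
    have ho := gramSchmidtNormed_orthonormal (𝕜 := ℝ) (hli hq)
    have hc : Fintype.card (Fin (Module.finrank ℝ E)) = Module.finrank ℝ (TangentSpace I q) :=
      Fintype.card_fin _
    have hsp := ho.linearIndependent.span_eq_top_of_card_eq_finrank' hc
    exact ⟨OrthonormalBasis.mk ho hsp.ge, fun i ↦ by simp⟩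

end Metric

section Nabla

variable [FiniteDimensional ℝ E] {X X' Y Y' Z U W : Π x : M, TangentSpace I x} {f : M → ℝ} {p : M}

/-- The vector field `∇_X Y`. -/
def nabla (X Y : Π x : M, TangentSpace I x) : Π x : M, TangentSpace I x :=
  fun q ↦ leviCivita I M Y q (X q)

/-- The coefficients of `∇_X Y` in a smooth orthonormal frame `e` are the Koszul expressions `koszul
I X Y (e i)`, which are smooth. This is what allows covariant derivatives to be iterated. -/
theorem smoothNear_nabla (hX : SmoothNear I X p) (hY : SmoothNear I Y p) :
    SmoothNear I (nabla X Y) p := by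
  have : CompleteSpace E := FiniteDimensional.complete ℝ E
  obtain ⟨e, he, hb⟩ := exists_orthonormal_frame (I := I) p
  have h : SmoothNear I (fun q ↦ ∑ i, koszul I X Y (e i) q • e i q) p :=
    SmoothNear.sum fun i _ ↦ SmoothNear.smul (smoothFunNear_koszul hX hY (he i)) (he i)
  refine h.congr ?_
  have he' : ∀ᶠ q in 𝓝 p, ∀ i, SmoothNear I (e i) q := eventually_all.2 fun i ↦ (he i).near
  filter_upwards [hX.near, hY.near, he', hb] with q h₁ h₂ h₃ ⟨b, hb⟩
  rw [← b.sum_repr' (nabla X Y q)]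
  refine Finset.sum_congr rfl fun i _ ↦ ?_
  rw [hb, real_inner_comm]
  exact congrArg (· • e i q) (inner_leviCivita I h₁.mdiff h₂.mdiff (h₃ i).mdiff)

theorem nabla_congr_left (h : X p = X' p) : nabla X Y p = nabla X' Y p := by
  rw [nabla, nabla, h]

theorem nabla_congr_right (hY : SmoothNear I Y p) (hY' : SmoothNear I Y' p) (h : Y =ᶠ[𝓝 p] Y') :
    nabla X Y p = nabla X Y' p :=
  congrArg (· (X p)) ((leviCivita I M).isCovariantDerivativeOnUniv.congr_of_eventuallyEq
    hY.mdiff hY'.mdiff univ_mem h)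

theorem nabla_add_left : nabla (X + X') Y = nabla X Y + nabla X' Y :=
  funext fun _ ↦ map_add _ _ _

theorem nabla_smul_left : nabla (f • X) Y = f • nabla X Y :=
  funext fun _ ↦ map_smul _ _ _

theorem nabla_add_right (hY : SmoothNear I Y p) (hY' : SmoothNear I Y' p) :
    nabla X (Y + Y') p = nabla X Y p + nabla X Y' p :=
  congrArg (· (X p)) ((leviCivita I M).isCovariantDerivativeOnUniv.add hY.mdiff hY'.mdiff)

theorem nabla_sub_right (hY : SmoothNear I Y p) (hY' : SmoothNear I Y' p) :
    nabla X (Y - Y') p = nabla X Y p - nabla X Y' p := by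
  have := nabla_add_right (X := X) (hY.sub hY') hY'
  rw [sub_add_cancel] at this
  rw [this, add_sub_cancel_right]

theorem nabla_smul_right (hf : SmoothFunNear I f p) (hY : SmoothNear I Y p) :
    nabla X (f • Y) p = f p • nabla X Y p + mvfderiv I f p (X p) • Y p :=
  congrArg (· (X p)) ((leviCivita I M).isCovariantDerivativeOnUniv.leibniz hY.mdiff hf.mdiff)

theorem nabla_sub_nabla (hX : SmoothNear I X p) (hY : SmoothNear I Y p) :
    nabla X Y p - nabla Y X p = mlieBracket I X Y p :=
  leviCivita_torsionFree I hX.mdiff hY.mdiff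

theorem mvfderiv_inner (hX : SmoothNear I X p) (hY : SmoothNear I Y p) (hZ : SmoothNear I Z p) :
    mvfderiv I (fun q ↦ inner ℝ (Y q) (Z q)) p (X p)
      = inner ℝ (nabla X Y p) (Z p) + inner ℝ (Y p) (nabla X Z p) :=
  leviCivita_metric I hX.mdiff hY.mdiff hZ.mdiff

end Nabla

end DirectedRiemannian

end

/-! ### Tensoriality, and the Bianchi identities for the curvature operator. -/

noncomputable section

namespace DirectedRiemannian

variable {E : Type*} [NormedAddCommGroup E] [NormedSpace ℝ E] [FiniteDimensional ℝ E]
  {H : Type*} [TopologicalSpace H] {I : ModelWithCorners ℝ E H}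
  {M : Type*} [TopologicalSpace M] [ChartedSpace H M] [IsManifold I ∞ M]

/-- An operation on smooth vector fields that is linear over the smooth functions only depends
on the value of the vector field at the point. -/
theorem eq_of_smooth_tensorial {A : Type*} [AddCommGroup A] [Module ℝ A] {p : M}
    {Φ : (Π x : M, TangentSpace I x) → A}
    (hadd : ∀ X X', SmoothNear I X p → SmoothNear I X' p → Φ (X + X') = Φ X + Φ X')
    (hsmul : ∀ f X, SmoothFunNear I f p → SmoothNear I X p → Φ (f • X) = f p • Φ X)
    {X X' : Π x : M, TangentSpace I x} (hX : SmoothNear I X p) (hX' : SmoothNear I X' p)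
    (h : X p = X' p) : Φ X = Φ X' := by
  classical
  have hloc {X X' : Π x : M, TangentSpace I x} (hX : SmoothNear I X p) (hX' : SmoothNear I X' p)
      (h : X =ᶠ[𝓝 p] X') : Φ X = Φ X' := by
    -- Locality needs no bump function: scalars only have to be smooth near `p`. The indicator of
    -- the set where `X` and `X'` agree is constantly 1 near `p`, and `ψ • X = ψ • X'` holds on all
    -- of `M`.
    let ψ (q : M) : ℝ := if X q = X' q then 1 else 0
    have hψp : ψ p = 1 := by simp [ψ, h.self_of_nhds]
    have hψ : SmoothFunNear I ψ p :=
      (SmoothFunNear.const 1).congr (h.mono fun q hq ↦ by simp [ψ, hq])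
    have hψX : ψ • X = ψ • X' := by
      funext q
      simp only [Pi.smul_apply', ψ]
      split_ifs with hq <;> simp [hq]
    have h1 := hsmul ψ X hψ hX
    have h2 := hsmul ψ X' hψ hX'
    rw [hψp, one_smul] at h1 h2
    rw [← h1, hψX, h2]
  have hzero : Φ 0 = 0 := by
    have := hadd 0 0 smoothNear_zero smoothNear_zero
    simpa using this
  have hsum {ι : Type _} (s : Finset ι) (F : ι → Π x : M, TangentSpace I x)
      (hF : ∀ i, SmoothNear I (F i) p) : Φ (fun q ↦ ∑ i ∈ s, F i q) = ∑ i ∈ s, Φ (F i) := by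
    induction s using Finset.induction_on with
    | empty => exact hzero
    | insert a s ha ih =>
      rw [Finset.sum_insert ha, ← ih, ← hadd _ _ (hF a) (SmoothNear.sum fun i _ ↦ hF i)]
      congr 1
      funext q
      simp [Finset.sum_insert ha]
  let t := trivializationAt E (TangentSpace I : M → Type _) p
  let B := Module.finBasis ℝ E
  let s := t.localFrame B
  let c := t.localFrameCoeff I B
  have hpt : p ∈ t.baseSet := FiberBundle.mem_baseSet_trivializationAt' p
  have hp : ∀ᶠ q in 𝓝 p, q ∈ t.baseSet := t.open_baseSet.mem_nhds hpt
  have hs (i) : SmoothNear I (s i) p := by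
    filter_upwards [hp] with q hq using contMDiffAt_localFrame_of_mem ∞ _ B i hq
  have hc {X : Π x : M, TangentSpace I x} (hX : SmoothNear I X p) (i) :
      SmoothFunNear I (LinearMap.piApply (c i) X) p := by
    filter_upwards [hp, hX] with q hq h₁ using contMDiffAt_localFrameCoeff B hq h₁ i
  -- In a local frame, locality and linearity reduce `Φ X` to a sum in which `X` enters only through
  -- its coefficients at `p`.
  have hexp {X : Π x : M, TangentSpace I x} (hX : SmoothNear I X p) :
      Φ X = ∑ i, c i p (X p) • Φ (s i) := by
    have h1 (i) : SmoothNear I (LinearMap.piApply (c i) X • s i) p := .smul (hc hX i) (hs i)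
    rw [hloc hX (X' := fun q ↦ ∑ i, (LinearMap.piApply (c i) X • s i) q)
      (SmoothNear.sum fun i _ ↦ h1 i)
      (t.eventually_eq_localFrame_sum_coeff_smul B hpt), hsum _ _ h1]
    exact Finset.sum_congr rfl fun i _ ↦ hsmul _ _ (hc hX i) (hs i)
  rw [hexp hX, hexp hX', h]

theorem mlieBracket_jacobi {X Y Z : Π x : M, TangentSpace I x} {p : M}
    (hX : SmoothNear I X p) (hY : SmoothNear I Y p) (hZ : SmoothNear I Z p) :
    mlieBracket I (mlieBracket I X Y) Z p + mlieBracket I (mlieBracket I Y Z) X p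
      + mlieBracket I (mlieBracket I Z X) Y p = 0 := by
  have : CompleteSpace E := FiniteDimensional.complete ℝ E
  have : IsManifold I (minSmoothness ℝ 3) M := by
    simpa using (inferInstance : IsManifold I 3 M)
  have two {X : Π x : M, TangentSpace I x} (hX : SmoothNear I X p) :
      CMDiffAt (minSmoothness ℝ 2) (T% X) p := by
    simpa using hX.contMDiffAt.of_le (m := 2) ENat.LEInfty.out
  have h := leibniz_identity_mlieBracket_apply (two hX) (two hY) (two hZ)
  rw [mlieBracket_swap_apply (V := X), mlieBracket_swap_apply (V := Y),
    mlieBracket_swap (V := X) (W := Z)] at h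
  have h2 : mlieBracket I (-mlieBracket I Z X) Y p = -mlieBracket I (mlieBracket I Z X) Y p := by
    have hZX := smoothNear_mlieBracket hZ hX
    have := mlieBracket_const_smul_left (I := I) (W := Y) (c := (-1 : ℝ)) hZX.mdiff
    simpa using this
  rw [h2] at h
  rw [← sub_eq_zero] at h
  refine Eq.trans ?_ ((congrArg Neg.neg h).trans neg_zero)
  abel

variable [RiemannianBundle (fun x : M ↦ TangentSpace I x)]
  [IsContMDiffRiemannianBundle I ∞ E (fun x : M ↦ TangentSpace I x)]

section Operator

variable {X X' Y Y' Z V U W : Π x : M, TangentSpace I x} {f : M → ℝ} {p : M}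

theorem curvatureOperator_eq :
    curvatureOperator I X Y Z
      = nabla X (nabla Y Z) - nabla Y (nabla X Z) - nabla (mlieBracket I X Y) Z := rfl

theorem smoothNear_curvatureOperator (hX : SmoothNear I X p) (hY : SmoothNear I Y p)
    (hZ : SmoothNear I Z p) : SmoothNear I (curvatureOperator I X Y Z) p := by
  have : CompleteSpace E := FiniteDimensional.complete ℝ E
  exact ((smoothNear_nabla hX (smoothNear_nabla hY hZ)).sub
    (smoothNear_nabla hY (smoothNear_nabla hX hZ))).sub
    (smoothNear_nabla (smoothNear_mlieBracket hX hY) hZ)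

theorem smoothFunNear_curvature (hX : SmoothNear I X p) (hY : SmoothNear I Y p)
    (hZ : SmoothNear I Z p) (hU : SmoothNear I U p) : SmoothFunNear I (curvature I X Y Z U) p :=
  smoothFunNear_inner (smoothNear_curvatureOperator hX hY hZ) hU

theorem curvatureOperator_swap :
    curvatureOperator I X Y Z p = -curvatureOperator I Y X Z p := by
  simp only [curvatureOperator, mlieBracket_swap_apply (V := Y) (W := X), map_neg]
  abel

theorem curvatureOperator_add_left (hX : SmoothNear I X p) (hX' : SmoothNear I X' p)
    (hZ : SmoothNear I Z p) :
    curvatureOperator I (X + X') Y Z p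
      = curvatureOperator I X Y Z p + curvatureOperator I X' Y Z p := by
  have : CompleteSpace E := FiniteDimensional.complete ℝ E
  simp only [curvatureOperator_eq, Pi.sub_apply, nabla_add_left, Pi.add_apply]
  rw [nabla_add_right (smoothNear_nabla hX hZ) (smoothNear_nabla hX' hZ),
    nabla_congr_left (X' := mlieBracket I X Y + mlieBracket I X' Y)
      (mlieBracket_add_left hX.mdiff hX'.mdiff), nabla_add_left, Pi.add_apply]
  abel

/-- The term with a derivative of `f` in `∇_Y (f ∇_X Z)` cancels the one that comes from `[fX, Y]`.
-/
theorem curvatureOperator_smul_left (hf : SmoothFunNear I f p) (hX : SmoothNear I X p)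
    (hZ : SmoothNear I Z p) :
    curvatureOperator I (f • X) Y Z p = f p • curvatureOperator I X Y Z p := by
  have : CompleteSpace E := FiniteDimensional.complete ℝ E
  simp only [curvatureOperator_eq, Pi.sub_apply, nabla_smul_left, Pi.smul_apply']
  rw [nabla_smul_right hf (smoothNear_nabla hX hZ)]
  have h : nabla (mlieBracket I (f • X) Y) Z p
      = -(mvfderiv I f p (Y p) • nabla X Z p) + f p • nabla (mlieBracket I X Y) Z p := by
    simp only [nabla, mlieBracket_smul_left hf.mdiff hX.mdiff, map_add, map_smul, neg_smul,
      map_neg]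
  rw [h]
  module

theorem curvatureOperator_congr_left (hX : SmoothNear I X p) (hX' : SmoothNear I X' p)
    (hZ : SmoothNear I Z p) (h : X p = X' p) :
    curvatureOperator I X Y Z p = curvatureOperator I X' Y Z p :=
  eq_of_smooth_tensorial (Φ := fun X ↦ curvatureOperator I X Y Z p)
    (fun _ _ h h' ↦ curvatureOperator_add_left h h' hZ)
    (fun _ _ hf h ↦ curvatureOperator_smul_left hf h hZ) hX hX' h

theorem curvatureOperator_sub_left (hX : SmoothNear I X p) (hX' : SmoothNear I X' p)
    (hZ : SmoothNear I Z p) :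
    curvatureOperator I (X - X') Y Z p
      = curvatureOperator I X Y Z p - curvatureOperator I X' Y Z p := by
  have := curvatureOperator_add_left (Y := Y) (hX.sub hX') hX' hZ
  rw [sub_add_cancel] at this
  rw [this, add_sub_cancel_right]

/-- The difference of two second covariant derivatives along `X` in terms of a Lie bracket. -/
theorem nabla_nabla_sub (hY : SmoothNear I Y p) (hZ : SmoothNear I Z p) :
    nabla X (nabla Y Z) p - nabla X (nabla Z Y) p = nabla X (mlieBracket I Y Z) p := by
  have : CompleteSpace E := FiniteDimensional.complete ℝ E
  have hYZ := smoothNear_nabla hY hZ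
  have hZY := smoothNear_nabla hZ hY
  rw [← nabla_sub_right hYZ hZY]
  refine nabla_congr_right (hYZ.sub hZY) (smoothNear_mlieBracket hY hZ) ?_
  filter_upwards [hY.near, hZ.near] with q h₁ h₂ using nabla_sub_nabla h₁ h₂

/-- The first Bianchi identity. -/
theorem curvatureOperator_bianchi (hX : SmoothNear I X p) (hY : SmoothNear I Y p)
    (hZ : SmoothNear I Z p) :
    curvatureOperator I X Y Z p + curvatureOperator I Y Z X p + curvatureOperator I Z X Y p = 0 := by
  have : CompleteSpace E := FiniteDimensional.complete ℝ E
  have hXY := smoothNear_mlieBracket hX hY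
  have hYZ := smoothNear_mlieBracket hY hZ
  have hZX := smoothNear_mlieBracket hZ hX
  have h1 := nabla_nabla_sub (X := X) hY hZ
  have h2 := nabla_nabla_sub (X := Y) hZ hX
  have h3 := nabla_nabla_sub (X := Z) hX hY
  have h4 := nabla_sub_nabla hXY hZ
  have h5 := nabla_sub_nabla hYZ hX
  have h6 := nabla_sub_nabla hZX hY
  have h7 := mlieBracket_jacobi hX hY hZ
  -- Torsion-freeness, used for the outer and then for the inner brackets, turns the Jacobi identity
  -- into the negative of the claim.
  rw [← h4, ← h5, ← h6, ← h1, ← h2, ← h3] at h7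
  simp only [curvatureOperator_eq, Pi.sub_apply]
  refine Eq.trans ?_ ((congrArg Neg.neg h7).trans neg_zero)
  abel

/-- The covariant derivative `(∇_W R)(X, Y) Z` of the curvature operator. -/
def covDerivOperator (W X Y Z : Π x : M, TangentSpace I x) (p : M) : TangentSpace I p :=
  nabla W (curvatureOperator I X Y Z) p - curvatureOperator I (nabla W X) Y Z p
    - curvatureOperator I X (nabla W Y) Z p - curvatureOperator I X Y (nabla W Z) p

theorem nabla_curvatureOperator (hX : SmoothNear I X p) (hY : SmoothNear I Y p)
    (hZ : SmoothNear I Z p) :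
    nabla W (curvatureOperator I X Y Z) p
      = nabla W (nabla X (nabla Y Z)) p - nabla W (nabla Y (nabla X Z)) p
        - nabla W (nabla (mlieBracket I X Y) Z) p := by
  have : CompleteSpace E := FiniteDimensional.complete ℝ E
  have h1 := smoothNear_nabla hX (smoothNear_nabla hY hZ)
  have h2 := smoothNear_nabla hY (smoothNear_nabla hX hZ)
  have h3 := smoothNear_nabla (smoothNear_mlieBracket hX hY) hZ
  rw [curvatureOperator_eq, nabla_sub_right (h1.sub h2) h3, nabla_sub_right h1 h2]

/-- By torsion-freeness, the terms of the second Bianchi sum that differentiate the first two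
arguments combine into terms with Lie brackets. -/
theorem curvatureOperator_nabla_nabla (hX : SmoothNear I X p) (hY : SmoothNear I Y p)
    (hV : SmoothNear I V p) :
    curvatureOperator I (nabla X Y) Z V p + curvatureOperator I Z (nabla Y X) V p
      = curvatureOperator I (mlieBracket I X Y) Z V p := by
  have : CompleteSpace E := FiniteDimensional.complete ℝ E
  have h1 := smoothNear_nabla hX hY
  have h2 := smoothNear_nabla hY hX
  rw [curvatureOperator_swap (X := Z), ← sub_eq_add_neg, ← curvatureOperator_sub_left h1 h2 hV]
  exact curvatureOperator_congr_left (h1.sub h2) (smoothNear_mlieBracket hX hY) hV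
    (nabla_sub_nabla hX hY)

/-- The second Bianchi identity. -/
theorem covDerivOperator_bianchi (hX : SmoothNear I X p) (hY : SmoothNear I Y p)
    (hZ : SmoothNear I Z p) (hV : SmoothNear I V p) :
    covDerivOperator X Y Z V p + covDerivOperator Y Z X V p + covDerivOperator Z X Y V p = 0 := by
  have : CompleteSpace E := FiniteDimensional.complete ℝ E
  have h1 := curvatureOperator_nabla_nabla (Z := Z) hX hY hV
  have h2 := curvatureOperator_nabla_nabla (Z := X) hY hZ hV
  have h3 := curvatureOperator_nabla_nabla (Z := Y) hZ hX hV
  have hJ : nabla (mlieBracket I (mlieBracket I X Y) Z) V p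
      + nabla (mlieBracket I (mlieBracket I Y Z) X) V p
      + nabla (mlieBracket I (mlieBracket I Z X) Y) V p = 0 := by
    simp only [nabla, ← map_add, mlieBracket_jacobi hX hY hZ, map_zero]
  simp only [covDerivOperator, nabla_curvatureOperator hY hZ hV,
    nabla_curvatureOperator hZ hX hV, nabla_curvatureOperator hX hY hV]
  -- Once the bracket terms are collected, the threefold derivatives cancel as in the Jacobi
  -- identity for commutators of the operators `∇_X`, `∇_Y`, `∇_Z`. The terms with one bracket
  -- cancel in pairs, and those with nested brackets vanish by `hJ`.
  have h4 : curvatureOperator I (nabla X Y) Z V p + curvatureOperator I Y (nabla X Z) V p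
      + (curvatureOperator I (nabla Y Z) X V p + curvatureOperator I Z (nabla Y X) V p)
      + (curvatureOperator I (nabla Z X) Y V p + curvatureOperator I X (nabla Z Y) V p)
      = curvatureOperator I (mlieBracket I X Y) Z V p
        + curvatureOperator I (mlieBracket I Y Z) X V p
        + curvatureOperator I (mlieBracket I Z X) Y V p := by
    rw [← h1, ← h2, ← h3]
    abel
  rw [← sub_eq_zero] at h4
  simp only [curvatureOperator_eq (X := mlieBracket I _ _), curvatureOperator_eq (Z := nabla _ _),
    Pi.sub_apply] at h4 ⊢
  refine Eq.trans ?_ ((congrArg₂ (fun a b ↦ -a + b) h4 hJ).trans (by simp))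
  abel

end Operator

end DirectedRiemannian

end

/-! ### Symmetries and tensoriality of `R` and `∇R`. -/

noncomputable section

namespace DirectedRiemannian

/-- The algebraic symmetries of a curvature tensor. -/
structure HasCurvatureSymmetries {α : Type*} (R : α → α → α → α → ℝ) : Prop where
  swap_left : ∀ x y z u, R x y z u = -R y x z u
  swap_right : ∀ x y z u, R x y z u = -R x y u z
  bianchi : ∀ x y z u, R x y z u + R y z x u + R z x y u = 0

namespace HasCurvatureSymmetries

variable {α β : Type*} {R : α → α → α → α → ℝ}

/-- The classical octahedron argument: the Bianchi identities for the four cyclic shifts of the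
arguments are combined, with signs supplied by the two skew symmetries. No linearity enters, so it
applies to vector fields as well as to tangent vectors. -/
theorem pair_swap (h : HasCurvatureSymmetries R) (x y z u : α) : R x y z u = R z u x y := by
  linarith [h.bianchi x y z u, h.bianchi y z u x, h.bianchi z u x y, h.bianchi u x y z,
    h.swap_right x y u z, h.swap_right y z x u, h.swap_left z x y u, h.swap_right x z y u,
    h.swap_right z u x y, h.swap_right u x y z, h.swap_left y u z x, h.swap_right y u x z,
    h.swap_left u y z x, h.swap_left x z u y, h.swap_left u x z y, h.swap_left u z x y,
    h.swap_left z y u x, h.swap_right u y z x, h.swap_right z x u y, h.swap_left y z u x]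

theorem comap (h : HasCurvatureSymmetries R) (f : β → α) :
    HasCurvatureSymmetries fun x y z u ↦ R (f x) (f y) (f z) (f u) :=
  ⟨fun _ _ _ _ ↦ h.swap_left _ _ _ _, fun _ _ _ _ ↦ h.swap_right _ _ _ _,
    fun _ _ _ _ ↦ h.bianchi _ _ _ _⟩

/-- The symmetries carry every slot to the first one, so tensoriality has to be checked there only.
-/
theorem congr {r : α → α → Prop} (h : HasCurvatureSymmetries R)
    (h₁ : ∀ {x x'} y z u, r x x' → R x y z u = R x' y z u) {x x' y y' z z' u u' : α}
    (hx : r x x') (hy : r y y') (hz : r z z') (hu : r u u') : R x y z u = R x' y' z' u' := by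
  rw [h₁ _ _ _ hx, h.swap_left, h₁ _ _ _ hy, ← h.swap_left, h.pair_swap, h₁ _ _ _ hz,
    h.swap_left, h₁ _ _ _ hu, ← h.swap_left, h.pair_swap]

end HasCurvatureSymmetries

variable {E : Type*} [NormedAddCommGroup E] [NormedSpace ℝ E]
  {H : Type*} [TopologicalSpace H] {I : ModelWithCorners ℝ E H}
  {M : Type*} [TopologicalSpace M] [ChartedSpace H M]

theorem mvfderiv_congr {f g : M → ℝ} {p : M} (h : f =ᶠ[𝓝 p] g) :
    mvfderiv I f p = mvfderiv I g p := by
  ext v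
  have := h.mfderiv_eq (I := I) (I' := 𝓘(ℝ, ℝ))
  simp only [mvfderiv, ContinuousLinearMap.comp_apply, this]
  rfl

variable [FiniteDimensional ℝ E] [IsManifold I ∞ M]
  [RiemannianBundle (fun x : M ↦ TangentSpace I x)]
  [IsContMDiffRiemannianBundle I ∞ E (fun x : M ↦ TangentSpace I x)]

section Curvature

variable {X X' Y Y' Z Z' V U U' W W' : Π x : M, TangentSpace I x} {f : M → ℝ} {p : M}

theorem curvature_swap_left : curvature I X Y Z U p = -curvature I Y X Z U p := by
  rw [curvature, curvatureOperator_swap, inner_neg_left, curvature]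

theorem mvfderiv_mvfderiv_inner (hX : SmoothNear I X p) (hY : SmoothNear I Y p)
    (hZ : SmoothNear I Z p) (hU : SmoothNear I U p) :
    mvfderiv I (fun q ↦ mvfderiv I (fun r ↦ inner ℝ (Z r) (U r)) q (Y q)) p (X p)
      = inner ℝ (nabla X (nabla Y Z) p) (U p) + inner ℝ (nabla Y Z p) (nabla X U p)
        + inner ℝ (nabla X Z p) (nabla Y U p) + inner ℝ (Z p) (nabla X (nabla Y U) p) := by
  have hYZ := smoothNear_nabla hY hZ
  have hYU := smoothNear_nabla hY hU
  have h : (fun q ↦ mvfderiv I (fun r ↦ inner ℝ (Z r) (U r)) q (Y q)) =ᶠ[𝓝 p]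
      fun q ↦ inner ℝ (nabla Y Z q) (U q) + inner ℝ (Z q) (nabla Y U q) := by
    filter_upwards [hY.near, hZ.near, hU.near] with q h₁ h₂ h₃ using mvfderiv_inner h₁ h₂ h₃
  rw [mvfderiv_congr h, mvfderiv_fun_add (smoothFunNear_inner hYZ hU).mdiff
    (smoothFunNear_inner hZ hYU).mdiff]
  simp only [add_apply, mvfderiv_inner hX hYZ hU, mvfderiv_inner hX hZ hYU]
  ring

/-- The operator `XY - YX - [X,Y]` annihilates the function `g(Z,U)`. Expanded by metric
compatibility, this reads `g(R(X,Y)Z,U) + g(Z,R(X,Y)U) = 0`, since the mixed first-order terms are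
symmetric in `X` and `Y`. -/
theorem curvature_swap_right (hX : SmoothNear I X p) (hY : SmoothNear I Y p)
    (hZ : SmoothNear I Z p) (hU : SmoothNear I U p) :
    curvature I X Y Z U p = -curvature I X Y U Z p := by
  have : CompleteSpace E := FiniteDimensional.complete ℝ E
  have h1 := mvfderiv_mlieBracket hX hY (smoothFunNear_inner hZ hU)
  rw [mvfderiv_mvfderiv_inner hX hY hZ hU, mvfderiv_mvfderiv_inner hY hX hZ hU,
    mvfderiv_inner (smoothNear_mlieBracket hX hY) hZ hU] at h1
  simp only [curvature, curvatureOperator_eq, Pi.sub_apply, inner_sub_left]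
  rw [real_inner_comm (Z p), real_inner_comm (Z p), real_inner_comm (Z p)]
  linarith

theorem curvature_bianchi (hX : SmoothNear I X p) (hY : SmoothNear I Y p)
    (hZ : SmoothNear I Z p) :
    curvature I X Y Z U p + curvature I Y Z X U p + curvature I Z X Y U p = 0 := by
  simp only [curvature, ← inner_add_left, curvatureOperator_bianchi hX hY hZ, inner_zero_left]

theorem curvature_add_left (hX : SmoothNear I X p) (hX' : SmoothNear I X' p)
    (hZ : SmoothNear I Z p) :
    curvature I (X + X') Y Z U p = curvature I X Y Z U p + curvature I X' Y Z U p := by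
  simp only [curvature, curvatureOperator_add_left hX hX' hZ, inner_add_left]

theorem curvature_smul_left (hf : SmoothFunNear I f p) (hX : SmoothNear I X p)
    (hZ : SmoothNear I Z p) :
    curvature I (f • X) Y Z U p = f p * curvature I X Y Z U p := by
  simp only [curvature, curvatureOperator_smul_left hf hX hZ, real_inner_smul_left]

variable (I) in
/-- The vector fields that are smooth near `p`. -/
abbrev SmoothField (p : M) := {X : Π x : M, TangentSpace I x // SmoothNear I X p}

theorem hasCurvatureSymmetries_curvature (p : M) :
    HasCurvatureSymmetries fun X Y Z U : SmoothField I p ↦ curvature I X.1 Y.1 Z.1 U.1 p :=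
  ⟨fun _ _ _ _ ↦ curvature_swap_left, fun X Y Z U ↦ curvature_swap_right X.2 Y.2 Z.2 U.2,
    fun X Y Z _ ↦ curvature_bianchi X.2 Y.2 Z.2⟩

theorem curvature_congr (hX : SmoothNear I X p) (hX' : SmoothNear I X' p)
    (hY : SmoothNear I Y p) (hY' : SmoothNear I Y' p) (hZ : SmoothNear I Z p)
    (hZ' : SmoothNear I Z' p) (hU : SmoothNear I U p) (hU' : SmoothNear I U' p)
    (hXX' : X p = X' p) (hYY' : Y p = Y' p) (hZZ' : Z p = Z' p) (hUU' : U p = U' p) :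
    curvature I X Y Z U p = curvature I X' Y' Z' U' p :=
  (hasCurvatureSymmetries_curvature p).congr (r := fun X X' ↦ X.1 p = X'.1 p)
    (x := ⟨X, hX⟩) (x' := ⟨X', hX'⟩) (y := ⟨Y, hY⟩) (y' := ⟨Y', hY'⟩) (z := ⟨Z, hZ⟩)
    (z' := ⟨Z', hZ'⟩) (u := ⟨U, hU⟩) (u' := ⟨U', hU'⟩)
    (fun {X X'} Y Z U h ↦ by
      simp only [curvature, curvatureOperator_congr_left X.2 X'.2 Z.2 h])
    hXX' hYY' hZZ' hUU'

theorem curvature_eq_curvatureAt (hX : SmoothNear I X p) (hY : SmoothNear I Y p)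
    (hZ : SmoothNear I Z p) (hU : SmoothNear I U p) :
    curvature I X Y Z U p = curvatureAt I p (X p) (Y p) (Z p) (U p) := by
  apply curvature_congr <;> first | assumption | exact smoothNear_extend _ | simp

/-- Metric compatibility absorbs the term with `∇_W U`. This transfers the second Bianchi identity
from the operator to the `(0,4)` tensor. -/
theorem covDerivCurvature_eq_inner (hW : SmoothNear I W p) (hX : SmoothNear I X p)
    (hY : SmoothNear I Y p) (hZ : SmoothNear I Z p) (hU : SmoothNear I U p) :
    covDerivCurvature I W X Y Z U p = inner ℝ (covDerivOperator W X Y Z p) (U p) := by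
  have h := mvfderiv_inner hW (smoothNear_curvatureOperator hX hY hZ) hU
  simp only [covDerivOperator, inner_sub_left]
  rw [← sub_eq_iff_eq_add.2 h]
  change mvfderiv I (fun q ↦ inner ℝ (curvatureOperator I X Y Z q) (U q)) p (W p)
    - inner ℝ (curvatureOperator I (nabla W X) Y Z p) (U p)
    - inner ℝ (curvatureOperator I X (nabla W Y) Z p) (U p)
    - inner ℝ (curvatureOperator I X Y (nabla W Z) p) (U p)
    - inner ℝ (curvatureOperator I X Y Z p) (nabla W U p) = _
  ring

theorem covDerivCurvature_eq : covDerivCurvature I W X Y Z U p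
    = mvfderiv I (curvature I X Y Z U) p (W p) - curvature I (nabla W X) Y Z U p
      - curvature I X (nabla W Y) Z U p - curvature I X Y (nabla W Z) U p
      - curvature I X Y Z (nabla W U) p := rfl

theorem covDerivCurvature_swap_left :
    covDerivCurvature I W X Y Z U p = -covDerivCurvature I W Y X Z U p := by
  have h : curvature I X Y Z U = fun q ↦ -curvature I Y X Z U q :=
    funext fun q ↦ curvature_swap_left
  simp only [covDerivCurvature_eq]
  rw [h, mvfderiv_fun_neg, curvature_swap_left (X := nabla W X),
    curvature_swap_left (Y := nabla W Y), curvature_swap_left (Z := nabla W Z),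
    curvature_swap_left (U := nabla W U), neg_apply]
  ring

theorem covDerivCurvature_swap_right (hW : SmoothNear I W p) (hX : SmoothNear I X p)
    (hY : SmoothNear I Y p) (hZ : SmoothNear I Z p) (hU : SmoothNear I U p) :
    covDerivCurvature I W X Y Z U p = -covDerivCurvature I W X Y U Z p := by
  have h : curvature I X Y Z U =ᶠ[𝓝 p] fun q ↦ -curvature I X Y U Z q := by
    filter_upwards [hX.near, hY.near, hZ.near, hU.near] with q h₁ h₂ h₃ h₄
      using curvature_swap_right h₁ h₂ h₃ h₄
  simp only [covDerivCurvature_eq]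
  rw [mvfderiv_congr h, mvfderiv_fun_neg, neg_apply,
    curvature_swap_right (smoothNear_nabla hW hX) hY hZ hU,
    curvature_swap_right hX (smoothNear_nabla hW hY) hZ hU,
    curvature_swap_right hX hY (smoothNear_nabla hW hZ) hU,
    curvature_swap_right hX hY hZ (smoothNear_nabla hW hU)]
  ring

theorem covDerivCurvature_bianchi (hW : SmoothNear I W p) (hX : SmoothNear I X p)
    (hY : SmoothNear I Y p) (hZ : SmoothNear I Z p) (hU : SmoothNear I U p) :
    covDerivCurvature I W X Y Z U p + covDerivCurvature I W Y Z X U p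
      + covDerivCurvature I W Z X Y U p = 0 := by
  have h : curvature I X Y Z U + curvature I Y Z X U + curvature I Z X Y U =ᶠ[𝓝 p] fun _ ↦ 0 := by
    filter_upwards [hX.near, hY.near, hZ.near] with q h₁ h₂ h₃ using curvature_bianchi h₁ h₂ h₃
  have h1 := smoothFunNear_curvature hX hY hZ hU
  have h2 := smoothFunNear_curvature hY hZ hX hU
  have h3 := smoothFunNear_curvature hZ hX hY hU
  have h4 := congrArg (· (W p)) (mvfderiv_congr (I := I) h)
  simp only [mvfderiv_const, zero_apply, mvfderiv_add (h1.mdiff.add h2.mdiff) h3.mdiff,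
    mvfderiv_add h1.mdiff h2.mdiff, add_apply] at h4
  simp only [covDerivCurvature_eq]
  linarith [curvature_bianchi (U := U) (smoothNear_nabla hW hX) hY hZ,
    curvature_bianchi (U := U) hX (smoothNear_nabla hW hY) hZ,
    curvature_bianchi (U := U) hX hY (smoothNear_nabla hW hZ),
    curvature_bianchi (U := nabla W U) hX hY hZ]

/-- The second Bianchi identity. -/
theorem covDerivCurvature_bianchi_left (hX : SmoothNear I X p) (hY : SmoothNear I Y p)
    (hZ : SmoothNear I Z p) (hV : SmoothNear I V p) (hU : SmoothNear I U p) :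
    covDerivCurvature I X Y Z V U p + covDerivCurvature I Y Z X V U p
      + covDerivCurvature I Z X Y V U p = 0 := by
  rw [covDerivCurvature_eq_inner hX hY hZ hV hU, covDerivCurvature_eq_inner hY hZ hX hV hU,
    covDerivCurvature_eq_inner hZ hX hY hV hU, ← inner_add_left, ← inner_add_left,
    covDerivOperator_bianchi hX hY hZ hV, inner_zero_left]

theorem covDerivCurvature_add_left (hW : SmoothNear I W p) (hX : SmoothNear I X p)
    (hX' : SmoothNear I X' p) (hY : SmoothNear I Y p) (hZ : SmoothNear I Z p)
    (hU : SmoothNear I U p) :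
    covDerivCurvature I W (X + X') Y Z U p
      = covDerivCurvature I W X Y Z U p + covDerivCurvature I W X' Y Z U p := by
  have h : curvature I (X + X') Y Z U =ᶠ[𝓝 p]
      fun q ↦ curvature I X Y Z U q + curvature I X' Y Z U q := by
    filter_upwards [hX.near, hX'.near, hZ.near] with q h₁ h₂ h₃ using curvature_add_left h₁ h₂ h₃
  have hWX := smoothNear_nabla hW hX
  have hWX' := smoothNear_nabla hW hX'
  have h1 : curvature I (nabla W (X + X')) Y Z U p
      = curvature I (nabla W X + nabla W X') Y Z U p :=
    curvature_congr (smoothNear_nabla hW (hX.add hX')) (hWX.add hWX') hY hY hZ hZ hU hU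
      (nabla_add_right hX hX') rfl rfl rfl
  simp only [covDerivCurvature_eq]
  rw [mvfderiv_congr h, mvfderiv_fun_add (smoothFunNear_curvature hX hY hZ hU).mdiff
    (smoothFunNear_curvature hX' hY hZ hU).mdiff, h1, curvature_add_left hWX hWX' hZ,
    curvature_add_left hX hX' hZ, curvature_add_left hX hX' (smoothNear_nabla hW hZ),
    curvature_add_left hX hX' hZ, add_apply]
  ring

theorem covDerivCurvature_smul_left (hW : SmoothNear I W p) (hf : SmoothFunNear I f p)
    (hX : SmoothNear I X p) (hY : SmoothNear I Y p) (hZ : SmoothNear I Z p)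
    (hU : SmoothNear I U p) :
    covDerivCurvature I W (f • X) Y Z U p = f p * covDerivCurvature I W X Y Z U p := by
  have h : curvature I (f • X) Y Z U =ᶠ[𝓝 p] fun q ↦ f q * curvature I X Y Z U q := by
    filter_upwards [hf.near, hX.near, hZ.near] with q h₁ h₂ h₃ using curvature_smul_left h₁ h₂ h₃
  have hWX := smoothNear_nabla hW hX
  -- The coefficient `W f` may be frozen at its value at `p`, because `curvature` at `p` only
  -- depends on the values of its arguments there. The resulting term cancels the one from the
  -- product rule.
  have hc : SmoothFunNear I (fun _ ↦ mvfderiv I f p (W p)) p := .const _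
  have h1 : curvature I (nabla W (f • X)) Y Z U p
      = curvature I (f • nabla W X + (fun _ : M ↦ mvfderiv I f p (W p)) • X) Y Z U p :=
    curvature_congr (smoothNear_nabla hW (.smul hf hX)) (.add (.smul hf hWX) (.smul hc hX))
      hY hY hZ hZ hU hU (nabla_smul_right hf hX) rfl rfl rfl
  simp only [covDerivCurvature_eq]
  rw [mvfderiv_congr h, mvfderiv_fun_mul hf.mdiff (smoothFunNear_curvature hX hY hZ hU).mdiff, h1,
    curvature_add_left (.smul hf hWX) (.smul hc hX) hZ, curvature_smul_left hf hWX hZ,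
    curvature_smul_left hc hX hZ, curvature_smul_left hf hX hZ,
    curvature_smul_left hf hX (smoothNear_nabla hW hZ), curvature_smul_left hf hX hZ]
  simp only [add_apply, smul_apply, smul_eq_mul]
  ring

theorem hasCurvatureSymmetries_covDerivCurvature (hW : SmoothNear I W p) :
    HasCurvatureSymmetries fun X Y Z U : SmoothField I p ↦
      covDerivCurvature I W X.1 Y.1 Z.1 U.1 p :=
  ⟨fun _ _ _ _ ↦ covDerivCurvature_swap_left,
    fun X Y Z U ↦ covDerivCurvature_swap_right hW X.2 Y.2 Z.2 U.2,
    fun X Y Z U ↦ covDerivCurvature_bianchi hW X.2 Y.2 Z.2 U.2⟩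

theorem covDerivCurvature_congr (hW : SmoothNear I W p) (hX : SmoothNear I X p)
    (hX' : SmoothNear I X' p)
    (hY : SmoothNear I Y p) (hY' : SmoothNear I Y' p) (hZ : SmoothNear I Z p)
    (hZ' : SmoothNear I Z' p) (hU : SmoothNear I U p) (hU' : SmoothNear I U' p)
    (hXX' : X p = X' p) (hYY' : Y p = Y' p) (hZZ' : Z p = Z' p) (hUU' : U p = U' p) :
    covDerivCurvature I W X Y Z U p = covDerivCurvature I W X' Y' Z' U' p :=
  (hasCurvatureSymmetries_covDerivCurvature hW).congr (r := fun X X' ↦ X.1 p = X'.1 p)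
    (x := ⟨X, hX⟩) (x' := ⟨X', hX'⟩) (y := ⟨Y, hY⟩) (y' := ⟨Y', hY'⟩) (z := ⟨Z, hZ⟩)
    (z' := ⟨Z', hZ'⟩) (u := ⟨U, hU⟩) (u' := ⟨U', hU'⟩)
    (fun {X X'} Y Z U h ↦
      eq_of_smooth_tensorial (Φ := fun X ↦ covDerivCurvature I W X Y.1 Z.1 U.1 p)
        (fun _ _ h h' ↦ covDerivCurvature_add_left hW h h' Y.2 Z.2 U.2)
        (fun _ _ hf h ↦ covDerivCurvature_smul_left hW hf h Y.2 Z.2 U.2) X.2 X'.2 h)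
    hXX' hYY' hZZ' hUU'

/-- The covariant derivative of the curvature tensor in terms of values of vector fields. -/
theorem covDerivCurvature_eq_curvatureAt (hW : SmoothNear I W p) (hX : SmoothNear I X p)
    (hY : SmoothNear I Y p) (hZ : SmoothNear I Z p) (hU : SmoothNear I U p) :
    covDerivCurvature I W X Y Z U p
      = mvfderiv I (curvature I X Y Z U) p (W p)
        - curvatureAt I p (leviCivita I M X p (W p)) (Y p) (Z p) (U p)
        - curvatureAt I p (X p) (leviCivita I M Y p (W p)) (Z p) (U p)
        - curvatureAt I p (X p) (Y p) (leviCivita I M Z p (W p)) (U p)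
        - curvatureAt I p (X p) (Y p) (Z p) (leviCivita I M U p (W p)) := by
  rw [covDerivCurvature_eq, curvature_eq_curvatureAt (smoothNear_nabla hW hX) hY hZ hU,
    curvature_eq_curvatureAt hX (smoothNear_nabla hW hY) hZ hU,
    curvature_eq_curvatureAt hX hY (smoothNear_nabla hW hZ) hU,
    curvature_eq_curvatureAt hX hY hZ (smoothNear_nabla hW hU)]
  rfl

/-- The last four fields are replaced by tensoriality. The direction `W` enters only through `W p`,
as the formula in terms of `curvatureAt` shows. -/
theorem covDerivCurvature_eq_covDerivCurvatureAt (hW : SmoothNear I W p) (hX : SmoothNear I X p)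
    (hY : SmoothNear I Y p) (hZ : SmoothNear I Z p) (hU : SmoothNear I U p) :
    covDerivCurvature I W X Y Z U p = covDerivCurvatureAt I p (W p) (X p) (Y p) (Z p) (U p) := by
  have hW' : SmoothNear I (extend E (W p) : Π x : M, TangentSpace I x) p := smoothNear_extend _
  rw [covDerivCurvatureAt, ← covDerivCurvature_congr hW' hX (smoothNear_extend _) hY
    (smoothNear_extend _) hZ (smoothNear_extend _) hU (smoothNear_extend _) (by simp) (by simp)
    (by simp) (by simp), covDerivCurvature_eq_curvatureAt hW hX hY hZ hU,
    covDerivCurvature_eq_curvatureAt hW' hX hY hZ hU, extend_apply_self]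

end Curvature

end DirectedRiemannian

end

/-! ### Linear algebra of curvature tensors. -/

noncomputable section

namespace DirectedRiemannian

/-- Algebraic curvature tensors: multilinear forms with the symmetries of a curvature tensor. -/
structure IsCurvatureTensor {V : Type*} [AddCommGroup V] [Module ℝ V]
    (R : V → V → V → V → ℝ) : Prop extends HasCurvatureSymmetries R where
  add_left : ∀ x x' y z u, R (x + x') y z u = R x y z u + R x' y z u
  smul_left : ∀ (c : ℝ) x y z u, R (c • x) y z u = c * R x y z u

namespace IsCurvatureTensor

section Module

variable {V : Type*} [AddCommGroup V] [Module ℝ V] {R R' : V → V → V → V → ℝ}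

theorem add_two (h : IsCurvatureTensor R) (x y y' z u : V) :
    R x (y + y') z u = R x y z u + R x y' z u := by
  rw [h.swap_left, h.add_left, h.swap_left x y, h.swap_left x y']
  ring

theorem smul_two (h : IsCurvatureTensor R) (c : ℝ) (x y z u : V) :
    R x (c • y) z u = c * R x y z u := by
  rw [h.swap_left, h.smul_left, h.swap_left x y]
  ring

theorem add_three (h : IsCurvatureTensor R) (x y z z' u : V) :
    R x y (z + z') u = R x y z u + R x y z' u := by
  rw [h.pair_swap, h.add_left, h.pair_swap x y z u, h.pair_swap x y z' u]

theorem smul_three (h : IsCurvatureTensor R) (c : ℝ) (x y z u : V) :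
    R x y (c • z) u = c * R x y z u := by
  rw [h.pair_swap, h.smul_left, ← h.pair_swap]

theorem add_right (h : IsCurvatureTensor R) (x y z u u' : V) :
    R x y z (u + u') = R x y z u + R x y z u' := by
  rw [h.pair_swap, h.add_two, h.pair_swap x y z u, h.pair_swap x y z u']

theorem smul_right (h : IsCurvatureTensor R) (c : ℝ) (x y z u : V) :
    R x y z (c • u) = c * R x y z u := by
  rw [h.pair_swap, h.smul_two, ← h.pair_swap]

theorem sub_smul (h : IsCurvatureTensor R) (h' : IsCurvatureTensor R') (c : ℝ) :
    IsCurvatureTensor fun x y z u ↦ R x y z u - c * R' x y z u where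
  swap_left x y z u := by rw [h.swap_left, h'.swap_left]; ring
  swap_right x y z u := by rw [h.swap_right, h'.swap_right]; ring
  bianchi x y z u := by linear_combination h.bianchi x y z u - c * h'.bianchi x y z u
  add_left x x' y z u := by rw [h.add_left, h'.add_left]; ring
  smul_left a x y z u := by rw [h.smul_left, h'.smul_left]; ring

theorem self_left (h : IsCurvatureTensor R) (x z u : V) : R x x z u = 0 := by
  linarith [h.swap_left x x z u]

theorem self_right (h : IsCurvatureTensor R) (x y z : V) : R x y z z = 0 := by
  linarith [h.swap_right x y z z]

theorem reverse (h : IsCurvatureTensor R) (x y z u : V) : R x y z u = R u z y x := by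
  rw [h.pair_swap, h.swap_left, h.swap_right, neg_neg]

/-- The sectional curvatures of a plane transform with the square of the determinant. -/
theorem sectional_eq (h : IsCurvatureTensor R) (a b c d : ℝ) (x y : V) :
    R (a • x + b • y) (c • x + d • y) (c • x + d • y) (a • x + b • y)
      = (a * d - b * c) ^ 2 * R x y y x := by
  simp only [h.add_left, h.add_two, h.add_three, h.add_right, h.smul_left, h.smul_two,
    h.smul_three, h.smul_right, h.self_left, h.self_right]
  rw [h.swap_left y x, h.swap_right x y x y]
  simp only [h.swap_left y x y x]
  ring

/-- An algebraic curvature tensor is determined by its sectional curvatures. -/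
theorem eq_zero (h : IsCurvatureTensor R) (h0 : ∀ x y, R x y y x = 0) (x y z u : V) :
    R x y z u = 0 := by
  have h1 (x y u : V) : R x y y u = 0 := by
    have := h0 (x + u) y
    simp only [h.add_left, h.add_right, h0] at this
    linarith [h.reverse x y y u]
  -- Now `R` is skew in the first two and in the middle two arguments, hence invariant under cyclic
  -- permutations of the first three. The Bianchi identity then says `3 R = 0`.
  have h2 (x y z u : V) : R x y z u = -R x z y u := by
    have := h1 x (y + z) u
    simp only [h.add_two, h.add_three, h1] at this
    linarith
  linarith [h.bianchi x y z u, h2 x y z u, h2 y z x u, h2 z x y u, h.swap_left x y z u,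
    h.swap_left y z x u, h.swap_left z x y u]

/-- Polarization of a sectional curvature with the direction in the plane. -/
theorem polarize {S : V → V → V → V → V → ℝ} (h : ∀ w, IsCurvatureTensor (S w))
    (hadd : ∀ w w' x y z u, S (w + w') x y z u = S w x y z u + S w' x y z u)
    (hsmul : ∀ (c : ℝ) w x y z u, S (c • w) x y z u = c * S w x y z u)
    (h0 : ∀ x y, S x x y y x = 0) (w x y : V) : S w x y y x + 2 * S x x y y w = 0 := by
  -- Half the difference of the two evaluations, at `x + w` and `x - w`, isolates the part linear in
  -- `w`: the cubic part vanishes by `h0`.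
  have h1 := h0 (x + w) y
  have h2 := h0 (x + (-1 : ℝ) • w) y
  simp only [hadd, hsmul, (h _).add_left, (h _).add_right, (h _).smul_left, (h _).smul_right,
    h0] at h1 h2
  linarith [(h x).reverse x y y w]

end Module

section Inner

variable {V : Type*} [NormedAddCommGroup V] [InnerProductSpace ℝ V] {R : V → V → V → V → ℝ}

/-- The curvature tensor of constant sectional curvature one. -/
theorem inner_mul_inner_sub : IsCurvatureTensor fun x y z u : V ↦
    inner ℝ x u * inner ℝ y z - inner ℝ x z * inner ℝ y u where
  swap_left x y z u := by ring
  swap_right x y z u := by ring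
  bianchi x y z u := by
    rw [real_inner_comm y x, real_inner_comm z x, real_inner_comm z y]
    ring
  add_left x x' y z u := by simp only [inner_add_left]; ring
  smul_left c x y z u := by simp only [real_inner_smul_left]; ring

variable {ι κ : Type*} [Fintype ι] [Fintype κ]

/-- The sum is the trace of the bilinear form `(x, u) ↦ R x y y u`. The two index types may differ,
as they do when a smooth frame is compared with `stdOrthonormalBasis`. -/
theorem sum_sectional_left (h : IsCurvatureTensor R) (b : OrthonormalBasis ι ℝ V)
    (c : OrthonormalBasis κ ℝ V) (y : V) : ∑ i, R (b i) y y (b i) = ∑ k, R (c k) y y (c k) := by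
  let B : V →ₗ[ℝ] V →ₗ[ℝ] ℝ := LinearMap.mk₂ ℝ (fun x u ↦ R x y y u)
    (fun _ _ _ ↦ h.add_left _ _ _ _ _) (fun _ _ _ ↦ h.smul_left _ _ _ _ _)
    (fun _ _ _ ↦ h.add_right _ _ _ _ _) (fun _ _ _ ↦ h.smul_right _ _ _ _ _)
  have hB (x : V) : B x x = ∑ k, ∑ l, inner ℝ (c k) x * inner ℝ (c l) x * B (c k) (c l) := by
    conv_lhs => rw [← c.sum_repr' x]
    simp only [map_sum, map_smul, LinearMap.sum_apply, LinearMap.smul_apply, smul_eq_mul,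
      Finset.mul_sum]
    rw [Finset.sum_comm]
    exact Finset.sum_congr rfl fun _ _ ↦ Finset.sum_congr rfl fun _ _ ↦ by ring
  have hc (k l : κ) : ∑ i, inner ℝ (c k) (b i) * inner ℝ (c l) (b i)
      = (inner ℝ (c k) (c l) : ℝ) := by
    rw [← b.sum_inner_mul_inner]
    exact Finset.sum_congr rfl fun i _ ↦ by rw [real_inner_comm (c l)]
  classical
  calc ∑ i, B (b i) (b i)
      = ∑ k, ∑ l, (inner ℝ (c k) (c l) : ℝ) * B (c k) (c l) := by
        simp only [hB, ← hc, Finset.sum_mul]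
        rw [Finset.sum_comm]
        exact Finset.sum_congr rfl fun _ _ ↦ Finset.sum_comm
    _ = ∑ k, B (c k) (c k) := by
        simp [orthonormal_iff_ite.1 c.orthonormal]

/-- The scalar curvature does not depend on the orthonormal basis. -/
theorem sum_sum_sectional (h : IsCurvatureTensor R) (b : OrthonormalBasis ι ℝ V)
    (c : OrthonormalBasis κ ℝ V) :
    ∑ i, ∑ j, R (b i) (b j) (b j) (b i) = ∑ k, ∑ l, R (c k) (c l) (c l) (c k) := by
  rw [Finset.sum_comm]
  simp only [h.sum_sectional_left b c]
  rw [Finset.sum_comm]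
  refine Finset.sum_congr rfl fun k _ ↦ ?_
  have h1 (x y : V) : R x y y x = R y x x y := by rw [h.pair_swap]
  simp only [h1 (c k)]
  exact h.sum_sectional_left b c (c k)

/-- A skew-symmetric variation of an orthonormal basis does not change the scalar curvature. -/
theorem sum_sum_skew (h : IsCurvatureTensor R) (b : OrthonormalBasis ι ℝ V) (a : ι → V)
    (ha : ∀ i j, (inner ℝ (a i) (b j) : ℝ) + inner ℝ (b i) (a j) = 0) :
    ∑ i, ∑ j, (R (a i) (b j) (b j) (b i) + R (b i) (a j) (b j) (b i)
      + R (b i) (b j) (a j) (b i) + R (b i) (b j) (b j) (a i)) = 0 := by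
  have hy (y : V) : ∑ i, R (a i) y y (b i) = 0 := by
    let B (u : V) : V →ₗ[ℝ] ℝ :=
      { toFun x := R x y y u
        map_add' _ _ := h.add_left _ _ _ _ _
        map_smul' _ _ := h.smul_left _ _ _ _ _ }
    have h1 (i : ι) : R (a i) y y (b i) = ∑ k, inner ℝ (b k) (a i) * R (b k) y y (b i) := by
      change B (b i) (a i) = _
      conv_lhs => rw [← b.sum_repr' (a i)]
      simp only [map_sum, map_smul, smul_eq_mul]
      rfl
    -- The coefficients are skew in `i` and `k`, while `R (b k) y y (b i)` is symmetric, so the sum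
    -- equals its own negative.
    have h2 : ∑ i, ∑ k, inner ℝ (b k) (a i) * R (b k) y y (b i)
        = -∑ i, ∑ k, inner ℝ (b k) (a i) * R (b k) y y (b i) := by
      conv_lhs => rw [Finset.sum_comm]
      simp only [← Finset.sum_neg_distrib]
      refine Finset.sum_congr rfl fun i _ ↦ Finset.sum_congr rfl fun k _ ↦ ?_
      rw [h.reverse (b i), real_inner_comm (a k), ← neg_mul,
        ← eq_neg_of_add_eq_zero_left (ha k i)]
    simp only [h1]
    linarith
  have e1 : ∑ i, ∑ j, R (a i) (b j) (b j) (b i) = 0 := by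
    rw [Finset.sum_comm]
    simp [hy]
  have e2 : ∑ i, ∑ j, R (b i) (a j) (b j) (b i) = 0 := by
    refine Finset.sum_eq_zero fun i _ ↦ ?_
    rw [← hy (b i)]
    exact Finset.sum_congr rfl fun j _ ↦ by rw [h.swap_left, h.swap_right, neg_neg]
  have h3 (i j : ι) : R (a i) (b j) (b j) (b i) + R (b i) (a j) (b j) (b i)
      + R (b i) (b j) (a j) (b i) + R (b i) (b j) (b j) (a i)
      = 2 * R (a i) (b j) (b j) (b i) + 2 * R (b i) (a j) (b j) (b i) := by
    rw [h.reverse (b i) (b j) (a j), h.reverse (b i) (b j) (b j)]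
    ring
  simp only [h3, Finset.sum_add_distrib, ← Finset.mul_sum, e1, e2]
  ring

/-- The covariant derivative of the curvature tensor is determined by a 1-form, if its sectional
1-forms are the restrictions of that 1-form. -/
theorem two_mul_sectional {T : V → V → V → V → V → ℝ} (h : ∀ w, IsCurvatureTensor (T w))
    (hadd : ∀ w w' x y z u, T (w + w') x y z u = T w x y z u + T w' x y z u)
    (hsmul : ∀ (c : ℝ) w x y z u, T (c • w) x y z u = c * T w x y z u)
    (hb : ∀ x y z u v, T x y z u v + T y z x u v + T z x y u v = 0) {η : V →ₗ[ℝ] ℝ}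
    (h0 : ∀ x y, T x x y y x
      = η x * (inner ℝ x x * inner ℝ y y - inner ℝ x y * inner ℝ y x)) (w x y : V) :
    2 * T w x y y x = η w * (inner ℝ x x * inner ℝ y y - inner ℝ x y * inner ℝ y x)
      + η x * (inner ℝ x w * inner ℝ y y - inner ℝ x y * inner ℝ y w)
      + η y * (inner ℝ y w * inner ℝ x x - inner ℝ y x * inner ℝ x w) := by
  -- Subtracting `η w` times the tensor of constant curvature one makes the hypothesis `h0`
  -- homogeneous, as polarization requires.
  have hS (w : V) := (h w).sub_smul inner_mul_inner_sub (η w)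
  have hp := polarize hS (fun w w' x y z u ↦ by rw [hadd, map_add]; ring)
    (fun c w x y z u ↦ by rw [hsmul, map_smul, smul_eq_mul]; ring)
    (fun x y ↦ by rw [h0, sub_self])
  have h1 := hp w x y
  have h2 := hp w y x
  -- Up to symmetries this is `T w x y y x = T x x y y w + T y y x x w`. Polarization, applied to
  -- `(x, y)` and to `(y, x)`, rewrites both summands through `T w x y y x` and `η`.
  have h3 := hb w x y y x
  rw [(h x).swap_left y w, (h x).pair_swap w y, (h x).swap_left y x, (h x).swap_right x y w y,
    (h y).pair_swap w x, (h y).swap_right] at h3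
  have h4 := (h w).pair_swap y x x y
  simp only [real_inner_comm x y] at h1 h2 ⊢
  linarith

theorem sum_sum_trace [DecidableEq ι] (b : OrthonormalBasis ι ℝ V) (η : V →ₗ[ℝ] ℝ) (w : V) :
    ∑ i, ∑ j, (η w * (inner ℝ (b i) (b i) * inner ℝ (b j) (b j)
          - inner ℝ (b i) (b j) * inner ℝ (b j) (b i))
        + η (b i) * (inner ℝ (b i) w * inner ℝ (b j) (b j)
          - inner ℝ (b i) (b j) * inner ℝ (b j) w)
        + η (b j) * (inner ℝ (b j) w * inner ℝ (b i) (b i)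
          - inner ℝ (b j) (b i) * inner ℝ (b i) w))
      = (Fintype.card ι - 1 : ℝ) * (Fintype.card ι + 2) * η w := by
  have hη : ∑ i, η (b i) * inner ℝ (b i) w = η w := by
    conv_rhs => rw [← b.sum_repr' w]
    simp only [map_sum, map_smul, smul_eq_mul]
    exact Finset.sum_congr rfl fun _ _ ↦ mul_comm _ _
  simp only [orthonormal_iff_ite.1 b.orthonormal, if_true, mul_one, mul_sub, ite_mul, one_mul,
    zero_mul, mul_ite, mul_zero, Finset.sum_add_distrib, Finset.sum_sub_distrib,
    Finset.sum_ite_eq, Finset.sum_ite_eq', Finset.mem_univ, Finset.sum_const, hη,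
    Finset.card_univ, nsmul_eq_mul, ← Finset.mul_sum]
  ring

end Inner

end IsCurvatureTensor

end DirectedRiemannian

end

/-! ### `R` and `∇R` on tangent vectors, and the differential of the scalar curvature. -/

noncomputable section

namespace DirectedRiemannian

variable {E : Type*} [NormedAddCommGroup E] [NormedSpace ℝ E] [FiniteDimensional ℝ E]
  {H : Type*} [TopologicalSpace H] {I : ModelWithCorners ℝ E H}
  {M : Type*} [TopologicalSpace M] [ChartedSpace H M] [IsManifold I ∞ M]
  [RiemannianBundle (fun x : M ↦ TangentSpace I x)]
  [IsContMDiffRiemannianBundle I ∞ E (fun x : M ↦ TangentSpace I x)]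
  {p : M}

section Pointwise

theorem isCurvatureTensor_curvatureAt (p : M) : IsCurvatureTensor (curvatureAt I p) where
  toHasCurvatureSymmetries := (hasCurvatureSymmetries_curvature p).comap
    fun v ↦ (⟨extend E v, smoothNear_extend v⟩ : SmoothField I p)
  add_left x x' y z u := by
    have hx := smoothNear_extend (I := I) x
    have hx' := smoothNear_extend (I := I) x'
    -- The sum of the chosen extensions need not be the chosen extension of the sum. Both have the
    -- same value at `p`, which suffices by tensoriality.
    have h := curvature_eq_curvatureAt (hx.add hx') (smoothNear_extend y) (smoothNear_extend z)
      (smoothNear_extend u)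
    rw [curvature_add_left hx hx' (smoothNear_extend z)] at h
    simpa [curvatureAt] using h.symm
  smul_left c x y z u := by
    have hx := smoothNear_extend (I := I) x
    have hc := SmoothFunNear.const (I := I) (p := p) c
    have h := curvature_eq_curvatureAt (.smul hc hx) (smoothNear_extend y) (smoothNear_extend z)
      (smoothNear_extend u)
    rw [curvature_smul_left hc hx (smoothNear_extend z)] at h
    simpa [curvatureAt] using h.symm

theorem isCurvatureTensor_covDerivCurvatureAt (w : TangentSpace I p) :
    IsCurvatureTensor (covDerivCurvatureAt I p w) where
  toHasCurvatureSymmetries := (hasCurvatureSymmetries_covDerivCurvature (smoothNear_extend w)).comap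
    fun v ↦ (⟨extend E v, smoothNear_extend v⟩ : SmoothField I p)
  add_left x x' y z u := by
    have hw := smoothNear_extend (I := I) w
    have hx := smoothNear_extend (I := I) x
    have hx' := smoothNear_extend (I := I) x'
    have h := covDerivCurvature_eq_covDerivCurvatureAt hw (hx.add hx') (smoothNear_extend y)
      (smoothNear_extend z) (smoothNear_extend u)
    rw [covDerivCurvature_add_left hw hx hx' (smoothNear_extend y) (smoothNear_extend z)
      (smoothNear_extend u)] at h
    simpa [covDerivCurvatureAt] using h.symm
  smul_left c x y z u := by
    have hw := smoothNear_extend (I := I) w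
    have hx := smoothNear_extend (I := I) x
    have hc := SmoothFunNear.const (I := I) (p := p) c
    have h := covDerivCurvature_eq_covDerivCurvatureAt hw (.smul hc hx) (smoothNear_extend y)
      (smoothNear_extend z) (smoothNear_extend u)
    rw [covDerivCurvature_smul_left hw hc hx (smoothNear_extend y) (smoothNear_extend z)
      (smoothNear_extend u)] at h
    simpa [covDerivCurvatureAt] using h.symm

/-- `∇R` at a point, with the direction of differentiation as a vector at this point. -/
theorem covDerivCurvatureAt_eq (w x y z u : TangentSpace I p) : covDerivCurvatureAt I p w x y z u
    = mvfderiv I (curvature I (extend E x) (extend E y) (extend E z) (extend E u)) p w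
      - curvatureAt I p (leviCivita I M (extend E x) p w) y z u
      - curvatureAt I p x (leviCivita I M (extend E y) p w) z u
      - curvatureAt I p x y (leviCivita I M (extend E z) p w) u
      - curvatureAt I p x y z (leviCivita I M (extend E u) p w) := by
  have h := covDerivCurvature_eq_curvatureAt (smoothNear_extend w) (smoothNear_extend x)
    (smoothNear_extend y) (smoothNear_extend z) (smoothNear_extend u)
  simp only [extend_apply_self] at h
  exact h

theorem covDerivCurvatureAt_add (w w' x y z u : TangentSpace I p) :
    covDerivCurvatureAt I p (w + w') x y z u
      = covDerivCurvatureAt I p w x y z u + covDerivCurvatureAt I p w' x y z u := by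
  have h := isCurvatureTensor_curvatureAt (I := I) p
  simp only [covDerivCurvatureAt_eq, map_add, h.add_left, h.add_two, h.add_three, h.add_right]
  ring

theorem covDerivCurvatureAt_smul (c : ℝ) (w x y z u : TangentSpace I p) :
    covDerivCurvatureAt I p (c • w) x y z u = c * covDerivCurvatureAt I p w x y z u := by
  have h := isCurvatureTensor_curvatureAt (I := I) p
  simp only [covDerivCurvatureAt_eq, map_smul, h.smul_left, h.smul_two, h.smul_three,
    h.smul_right, smul_eq_mul]
  ring

theorem covDerivCurvatureAt_bianchi (x y z u v : TangentSpace I p) :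
    covDerivCurvatureAt I p x y z u v + covDerivCurvatureAt I p y z x u v
      + covDerivCurvatureAt I p z x y u v = 0 :=
  covDerivCurvature_bianchi_left (smoothNear_extend x) (smoothNear_extend y)
    (smoothNear_extend z) (smoothNear_extend u) (smoothNear_extend v)

/-- The differential of the scalar curvature is the trace of `∇R`. -/
theorem exists_mvfderiv_scalarCurvature (p : M) :
    MDiffAt (scalarCurvature I : M → ℝ) p ∧
    ∃ b : OrthonormalBasis (Fin (Module.finrank ℝ E)) ℝ (TangentSpace I p),
      ∀ w, mvfderiv I (scalarCurvature I) p w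
        = ∑ i, ∑ j, covDerivCurvatureAt I p w (b i) (b j) (b j) (b i) := by
  obtain ⟨e, he, hb⟩ := exists_orthonormal_frame (I := I) p
  have he' : ∀ᶠ q in 𝓝 p, ∀ i, SmoothNear I (e i) q := eventually_all.2 fun i ↦ (he i).near
  -- The bases in `scalarCurvature` are chosen separately at each point, with no regularity.
  -- Independence of the basis replaces them by a smooth frame.
  have hτ : (scalarCurvature I : M → ℝ) =ᶠ[𝓝 p]
      fun q ↦ ∑ i, ∑ j, curvature I (e i) (e j) (e j) (e i) q := by
    filter_upwards [he', hb] with q h₁ ⟨b, hb⟩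
    rw [scalarCurvature, (isCurvatureTensor_curvatureAt q).sum_sum_sectional _ b]
    refine Finset.sum_congr rfl fun i _ ↦ Finset.sum_congr rfl fun j _ ↦ ?_
    rw [curvature_eq_curvatureAt (h₁ i) (h₁ j) (h₁ j) (h₁ i), hb, hb]
  have hs (i j) : SmoothFunNear I (curvature I (e i) (e j) (e j) (e i)) p :=
    smoothFunNear_curvature (he i) (he j) (he j) (he i)
  have hs' (i) : SmoothFunNear I (fun q ↦ ∑ j, curvature I (e i) (e j) (e j) (e i) q) p :=
    .sum fun j _ ↦ hs i j
  refine ⟨((SmoothFunNear.sum fun i _ ↦ hs' i).congr hτ).mdiff, ?_⟩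
  obtain ⟨b, hbp⟩ := hb.self_of_nhds
  refine ⟨b, fun w ↦ ?_⟩
  -- The inner products of the frame fields are locally constant, so the matrix of `∇_w e` is skew.
  -- By `sum_sum_skew`, the correction terms in the trace of `∇R` cancel.
  have hskew (i j) : (inner ℝ (leviCivita I M (e i) p w) (b j) : ℝ)
      + inner ℝ (b i) (leviCivita I M (e j) p w) = 0 := by
    have h1 := mvfderiv_inner (smoothNear_extend w) (he i) (he j)
    have h2 : (fun q ↦ (inner ℝ (e i q) (e j q) : ℝ)) =ᶠ[𝓝 p] fun _ ↦ if i = j then 1 else 0 := by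
      filter_upwards [hb] with q ⟨b, hb⟩
      rw [← hb, ← hb, orthonormal_iff_ite.1 b.orthonormal]
    rw [mvfderiv_congr h2, mvfderiv_const, ← hbp, ← hbp] at h1
    simpa [nabla] using h1.symm
  have hsum := (isCurvatureTensor_curvatureAt p).sum_sum_skew b
    (fun i ↦ leviCivita I M (e i) p w) hskew
  have hd (i j) : covDerivCurvatureAt I p w (b i) (b j) (b j) (b i)
      = mvfderiv I (curvature I (e i) (e j) (e j) (e i)) p w
        - (curvatureAt I p (leviCivita I M (e i) p w) (b j) (b j) (b i)
          + curvatureAt I p (b i) (leviCivita I M (e j) p w) (b j) (b i)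
          + curvatureAt I p (b i) (b j) (leviCivita I M (e j) p w) (b i)
          + curvatureAt I p (b i) (b j) (b j) (leviCivita I M (e i) p w)) := by
    have h1 := covDerivCurvature_eq_covDerivCurvatureAt (smoothNear_extend w) (he i) (he j) (he j)
      (he i)
    rw [covDerivCurvature_eq_curvatureAt (smoothNear_extend w) (he i) (he j) (he j) (he i),
      ← hbp, ← hbp, extend_apply_self] at h1
    rw [← h1]
    ring
  simp only [hd, Finset.sum_sub_distrib, hsum, sub_zero]
  rw [mvfderiv_congr hτ]
  have hsum' {F : Fin (Module.finrank ℝ E) → M → ℝ} (hF : ∀ i, SmoothFunNear I (F i) p)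
      (s : Finset (Fin (Module.finrank ℝ E))) :
      mvfderiv I (fun q ↦ ∑ i ∈ s, F i q) p w = ∑ i ∈ s, mvfderiv I (F i) p w := by
    induction s using Finset.induction_on with
    | empty => simp [mvfderiv_const]
    | insert a s ha ih =>
      simp only [Finset.sum_insert ha]
      rw [mvfderiv_fun_add (hF a).mdiff (SmoothFunNear.sum fun i _ ↦ hF i).mdiff, add_apply, ih]
  rw [hsum' hs']
  exact Finset.sum_congr rfl fun i _ ↦ hsum' (hs i) _

end Pointwise

/-! ### Consequences of being directed at a single point. -/

section Directed

variable {η : Π p : M, TangentSpace I p →L[ℝ] ℝ}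

/-- The common value of the relative sectional curvatures at a point, which is only relevant in
dimension at least two. -/
theorem exists_relativeSectionalCurvature (hη : IsDirectedBy η)
    (hk : HasPointwiseConstantRelativeSectionalCurvature η) (p : M) :
    ∃ k : ℝ, (k ≠ 0 → 2 ≤ Module.finrank ℝ E) ∧
      ∀ (P : Submodule ℝ (TangentSpace I p)) (hP : Module.finrank ℝ P = 2) (z : P),
        sectionalForm I P hP z = k * η p z := by
  by_cases h : ∃ (P : Submodule ℝ (TangentSpace I p)) (_ : Module.finrank ℝ P = 2),
      ¬ P ≤ distribution η p
  · obtain ⟨Q, hQ, hQη⟩ := h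
    refine ⟨relativeSectionalCurvature η Q hQ, fun _ ↦ hQ ▸ Submodule.finrank_le Q,
      fun P hP z ↦ ?_⟩
    -- Planes inside `Δ` satisfy the formula with any `k`, since both sides vanish there.
    by_cases hPη : P ≤ distribution η p
    · have hz : η p z = 0 := hPη z.2
      rw [hη.vanishing p P hP hPη, hz, mul_zero]
    · rw [← hk p P Q hP hQ hPη hQη]
      exact Classical.epsilon_spec (hη.collinear p P hP hPη) z
  -- Without a 2-plane outside `Δ` all sectional forms vanish and `k = 0` serves. This case includes
  -- dimension at most one.
  · push Not at h
    refine ⟨0, fun h0 ↦ absurd rfl h0, fun P hP z ↦ ?_⟩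
    rw [hη.vanishing p P hP (h P hP), zero_mul]

/-- With the direction `x` held fixed, the difference of the two sides is a sectional curvature of
an algebraic curvature tensor. It vanishes for dependent `x`, `y`. Otherwise it is a squared
determinant times its value on an orthonormal basis of the span, and that value is zero by
hypothesis because `x` lies in the span. -/
theorem covDerivCurvatureAt_of_sectionalForm {η : TangentSpace I p →L[ℝ] ℝ} {k : ℝ}
    (h : ∀ (P : Submodule ℝ (TangentSpace I p)) (hP : Module.finrank ℝ P = 2) (z : P),
      sectionalForm I P hP z = k * η z) (x y : TangentSpace I p) :
    covDerivCurvatureAt I p x x y y x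
      = k * η x * (inner ℝ x x * inner ℝ y y - inner ℝ x y * inner ℝ y x) := by
  have hS := (isCurvatureTensor_covDerivCurvatureAt x).sub_smul
    IsCurvatureTensor.inner_mul_inner_sub (k * η x)
  rw [← sub_eq_zero]
  by_cases hx : x = 0
  · subst hx
    have := hS.smul_left 0 (0 : TangentSpace I p) y y (0 : TangentSpace I p)
    simpa using this
  by_cases hxy : ∃ a : ℝ, a • x = y
  · obtain ⟨a, rfl⟩ := hxy
    exact (hS.smul_two a x x (a • x) x).trans (by rw [hS.self_left, mul_zero])
  have hli : LinearIndependent ℝ ![x, y] :=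
    (LinearIndependent.pair_iff' hx).2 fun a ha ↦ hxy ⟨a, ha⟩
  let P : Submodule ℝ (TangentSpace I p) := Submodule.span ℝ (Set.range ![x, y])
  have hP : Module.finrank ℝ P = 2 := by simpa using finrank_span_eq_card hli
  have hxP : x ∈ P := Submodule.subset_span ⟨0, rfl⟩
  have hyP : y ∈ P := Submodule.subset_span ⟨1, rfl⟩
  let e := (stdOrthonormalBasis ℝ P).reindex (finCongr hP)
  have hexp {v : TangentSpace I p} (hv : v ∈ P) :
      v = e.repr ⟨v, hv⟩ 0 • (e 0 : TangentSpace I p)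
        + e.repr ⟨v, hv⟩ 1 • (e 1 : TangentSpace I p) := by
    have := congrArg Subtype.val (e.sum_repr ⟨v, hv⟩)
    rw [Fin.sum_univ_two] at this
    exact this.symm
  have he (i j : Fin 2) : (inner ℝ (e i : TangentSpace I p) (e j : TangentSpace I p) : ℝ)
      = if i = j then 1 else 0 := orthonormal_iff_ite.1 e.orthonormal i j
  have h0 := h P hP ⟨x, hxP⟩
  change covDerivCurvatureAt I p x (e 0) (e 1) (e 1) (e 0) = k * η x at h0
  have h1 := hS.sectional_eq (e.repr ⟨x, hxP⟩ 0) (e.repr ⟨x, hxP⟩ 1) (e.repr ⟨y, hyP⟩ 0)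
    (e.repr ⟨y, hyP⟩ 1) (e 0 : TangentSpace I p) (e 1 : TangentSpace I p)
  rw [← hexp hxP, ← hexp hyP, h0] at h1
  have hn (i : Fin 2) : ‖(e i : TangentSpace I p)‖ = 1 := e.orthonormal.1 i
  simpa [he, hn] using h1

end Directed

end DirectedRiemannian

end

/-! ### The equivalence. -/

theorem corollary2p5
    {E : Type*} [NormedAddCommGroup E] [NormedSpace ℝ E] [FiniteDimensional ℝ E]
    {M : Type*} [TopologicalSpace M] [ChartedSpace E M] [IsManifold 𝓘(ℝ, E) ∞ M]
    [RiemannianBundle (fun x : M ↦ TangentSpace 𝓘(ℝ, E) x)]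
    [IsContMDiffRiemannianBundle 𝓘(ℝ, E) ∞ E (fun x : M ↦ TangentSpace 𝓘(ℝ, E) x)]
    (η : Π p : M, TangentSpace 𝓘(ℝ, E) p →L[ℝ] ℝ)
    (hη : DirectedRiemannian.IsDirectedBy η)
    (hk : DirectedRiemannian.HasPointwiseConstantRelativeSectionalCurvature η) :
    DirectedRiemannian.IsLocallySymmetric 𝓘(ℝ, E) M ↔
      ∀ p : M, HasMFDerivAt 𝓘(ℝ, E) 𝓘(ℝ, ℝ)
        (fun q : M ↦ DirectedRiemannian.scalarCurvature 𝓘(ℝ, E) q) p 0 := by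
  open DirectedRiemannian in
  constructor
  · intro hR p
    obtain ⟨hτ, b, hb⟩ := exists_mvfderiv_scalarCurvature (I := 𝓘(ℝ, E)) p
    have h0 : mfderiv 𝓘(ℝ, E) 𝓘(ℝ, ℝ) (scalarCurvature 𝓘(ℝ, E)) p = 0 := by
      ext w
      refine (hb w).trans ?_
      exact Finset.sum_eq_zero fun i _ ↦ Finset.sum_eq_zero fun j _ ↦ hR p _ _ _ _ _
    exact h0 ▸ hτ.hasMFDerivAt
  · intro hτ p w
    obtain ⟨k, hk2, hsec⟩ := exists_relativeSectionalCurvature hη hk p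
    have key := IsCurvatureTensor.two_mul_sectional
      (fun w : TangentSpace 𝓘(ℝ, E) p ↦ isCurvatureTensor_covDerivCurvatureAt w)
      covDerivCurvatureAt_add covDerivCurvatureAt_smul covDerivCurvatureAt_bianchi
      (η := k • (η p : TangentSpace 𝓘(ℝ, E) p →ₗ[ℝ] ℝ))
      (covDerivCurvatureAt_of_sectionalForm hsec)
    have hk0 : k = 0 := by
      obtain ⟨v, hv⟩ : ∃ v, η p v ≠ 0 := by
        by_contra! h
        have h1 : ‖η p‖ ≤ 0 := (η p).opNorm_le_bound le_rfl fun v ↦ by simp [h]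
        rw [hη.unit p] at h1
        linarith
      obtain ⟨-, b, hb⟩ := exists_mvfderiv_scalarCurvature (I := 𝓘(ℝ, E)) p
      have h1 : mvfderiv 𝓘(ℝ, E) (scalarCurvature 𝓘(ℝ, E)) p v = 0 :=
        congrArg (· v) (hτ p).mfderiv
      -- The trace of `key` is `2 dτ(v) = (n - 1)(n + 2) k η(v)`, whose left side is zero by `h1`.
      have h2 := IsCurvatureTensor.sum_sum_trace b
        (k • (η p : TangentSpace 𝓘(ℝ, E) p →ₗ[ℝ] ℝ)) v
      simp only [← key, ← Finset.mul_sum] at h2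
      rw [← hb v, h1, mul_zero, Fintype.card_fin] at h2
      by_contra hne
      -- The bound is needed for the factor `n - 1`, which would vanish in dimension one.
      have hn : (2 : ℝ) ≤ Module.finrank ℝ E := by exact_mod_cast hk2 hne
      refine absurd h2.symm (mul_ne_zero (mul_ne_zero ?_ ?_) (mul_ne_zero hne hv)) <;>
        linarith
    refine (isCurvatureTensor_covDerivCurvatureAt w).eq_zero fun x y ↦ ?_
    have := key w x y
    simpa [hk0] using this
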